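/- Let $M$ be a separable finite von Neumann algebra with a fixed faithful normal tracial state $\tau$, where separable means that the Hilbert space $L^2(M)=L^2(M,\tau)$ is separable. Write $\|x\|_2=\tau(x^*x)^{1/2}$ for $x\in M$. Let $A\subseteq M$ be a von Neumann subalgebra (with the same unit) that is diffuse, i.e. has no minimal projections. Let $L^2(A)$ be the closure of $A$ in $L^2(M)$, and let $E_A:M\to A$ be the $\tau$-preserving conditional expectation. Let $Y\subseteq M$ be a subset whose linear span is $\|\cdot\|_2$-dense in $L^2(M)$, and let $\{v_n\}_{n\in\mathbb N}\subseteq A$ be an orthonormal basis of $L^2(A)$. Suppose that $$\sum_{n}\|E_A(av_nb)-E_A(a)v_nE_A(b)\|_2^2<\infty\qquad\text{for all } a,b\in Y .$$ Then $A$ is mixing in $M$: for every sequence $(u_n)$ of unitaries of $A$ that converges to $0$ in the weak operator topology, $$\lim_{n\to\infty}\|E_A(au_nb)-E_A(a)u_nE_A(b)\|_2=0\qquad\text{for all } a,b\in M .$$ In particular, $A$ is singular in $M$: every unitary $u\in M$ with $uAu^*=A$ belongs to $A$. -/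

import Mathlib

open Filter Topology
open scoped InnerProductSpace ComplexOrder

noncomputable section

namespace FiniteVN

universe u

variable {H : Type u} [NormedAddCommGroup H] [InnerProductSpace ℂ H] [CompleteSpace H]

/-- The type of elements of a von Neumann algebra `M` on `H`, as a unital star algebra. -/
abbrev Elem (M : VonNeumannAlgebra H) : Type u := ↥M.toStarSubalgebra

/-- A faithful normal tracial state on the von Neumann algebra `M`. A von Neumann algebra together
with such a `τ` is a finite von Neumann algebra `(M, τ)`. -/
structure FaithfulNormalTrace (M : VonNeumannAlgebra H) where
  /-- the underlying linear functional -/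
  toLinearMap : Elem M →ₗ[ℂ] ℂ
  map_one : toLinearMap 1 = 1
  nonneg : ∀ x : Elem M, 0 ≤ toLinearMap (star x * x)
  faithful : ∀ x : Elem M, toLinearMap (star x * x) = 0 → x = 0
  tracial : ∀ x y : Elem M, toLinearMap (x * y) = toLinearMap (y * x)
  /-- Normality, i.e. continuity for the ultraweak (= σ-weak) topology. -/
  normal : ∃ ξ η : ℕ → H, (Summable fun i => ‖ξ i‖ ^ 2) ∧ (Summable fun i => ‖η i‖ ^ 2) ∧
    ∀ x : Elem M, HasSum (fun i => ⟪η i, (x : H →L[ℂ] H) (ξ i)⟫_ℂ) (toLinearMap x)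

namespace FaithfulNormalTrace

variable {M : VonNeumannAlgebra H}

instance : CoeFun (FaithfulNormalTrace M) (fun _ => Elem M → ℂ) := ⟨fun τ => τ.toLinearMap⟩

theorem map_star (τ : FaithfulNormalTrace M) (x : Elem M) :
    τ (star x) = (starRingEnd ℂ) (τ x) := by
  have h0 := (Complex.nonneg_iff.mp (τ.nonneg x)).2
  have h1 := (Complex.nonneg_iff.mp (τ.nonneg (1 + x))).2
  have h2 := (Complex.nonneg_iff.mp (τ.nonneg (1 + Complex.I • x))).2
  have e1 : star (1 + x) * (1 + x) = 1 + x + star x + star x * x := by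
    rw [star_add, star_one]; noncomm_ring
  have e2 : star (1 + Complex.I • x) * (1 + Complex.I • x)
      = 1 + Complex.I • x - Complex.I • star x + star x * x := by
    rw [star_add, star_one, star_smul, add_mul, mul_add, mul_add, smul_mul_smul_comm]
    simp [sub_eq_add_neg, add_assoc]
  rw [e1] at h1
  rw [e2] at h2
  simp only [map_add, map_sub, map_smul, τ.map_one, Complex.add_im, Complex.sub_im,
    Complex.one_im, smul_eq_mul, Complex.mul_im, Complex.I_re, Complex.I_im] at h1 h2
  apply Complex.ext
  · rw [Complex.conj_re]; linarith
  · rw [Complex.conj_im]; linarith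

/-- The norm `‖x‖₂ = τ(x* x)^{1/2}`. -/
def norm₂ (τ : FaithfulNormalTrace M) (x : Elem M) : ℝ := √(τ (star x * x)).re

/-- `M` as a pre-Hilbert space for the inner product `⟨x, y⟩ = τ(x* y)`. -/
def PreL2 (_τ : FaithfulNormalTrace M) : Type u := Elem M

instance (τ : FaithfulNormalTrace M) : AddCommGroup τ.PreL2 := inferInstanceAs (AddCommGroup (Elem M))
instance (τ : FaithfulNormalTrace M) : Module ℂ τ.PreL2 := inferInstanceAs (Module ℂ (Elem M))

/-- The identification of `M` with the vectors of the pre-Hilbert space. -/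
def toPreL2 (τ : FaithfulNormalTrace M) : Elem M ≃ₗ[ℂ] τ.PreL2 := LinearEquiv.refl ℂ _

/-- The inner product `⟨x, y⟩ = τ(x* y)` on `M`. -/
abbrev innerCore (τ : FaithfulNormalTrace M) : InnerProductSpace.Core ℂ τ.PreL2 where
  inner x y := τ (star (τ.toPreL2.symm x) * τ.toPreL2.symm y)
  conj_inner_symm x y := by
    rw [← τ.map_star]; simp
  re_inner_nonneg x := (Complex.nonneg_iff.mp (τ.nonneg _)).1
  add_left x y z := by simp [add_mul]
  smul_left x y r := by simp
  definite x hx := by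
    have := τ.faithful _ hx
    simpa using this

instance (τ : FaithfulNormalTrace M) : NormedAddCommGroup τ.PreL2 :=
  InnerProductSpace.Core.toNormedAddCommGroup (cd := τ.innerCore)
instance (τ : FaithfulNormalTrace M) : InnerProductSpace ℂ τ.PreL2 :=
  InnerProductSpace.ofCore τ.innerCore.toCore

/-- The Hilbert space `L²(M) = L²(M, τ)`. -/
abbrev L2 (τ : FaithfulNormalTrace M) : Type u := UniformSpace.Completion τ.PreL2

/-- The canonical embedding `M → L²(M)`. -/
def toL2 (τ : FaithfulNormalTrace M) : Elem M →ₗ[ℂ] τ.L2 :=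
  (UniformSpace.Completion.toComplL (𝕜 := ℂ) (E := τ.PreL2)).toLinearMap ∘ₗ τ.toPreL2.toLinearMap

theorem inner_toL2 (τ : FaithfulNormalTrace M) (x y : Elem M) :
    ⟪τ.toL2 x, τ.toL2 y⟫_ℂ = τ (star x * y) :=
  UniformSpace.Completion.inner_coe (𝕜 := ℂ) (τ.toPreL2 x) (τ.toPreL2 y)

theorem norm_toL2 (τ : FaithfulNormalTrace M) (x : Elem M) : ‖τ.toL2 x‖ = τ.norm₂ x := by
  rw [norm_eq_sqrt_re_inner (𝕜 := ℂ), inner_toL2]; rfl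

/-- The elements of `M` that lie in `A`, as a linear subspace of `M`. -/
def subspace (M A : VonNeumannAlgebra H) : Submodule ℂ (Elem M) where
  carrier := {x | (x : H →L[ℂ] H) ∈ A}
  add_mem' hx hy := A.toStarSubalgebra.add_mem hx hy
  zero_mem' := A.toStarSubalgebra.zero_mem
  smul_mem' c _ hx := A.toStarSubalgebra.smul_mem hx c

/-- `L²(A)`: the closure of `A` in `L²(M)`, for `A ⊆ M`. -/
def L2Sub (τ : FaithfulNormalTrace M) (A : VonNeumannAlgebra H) : Submodule ℂ τ.L2 :=
  ((subspace M A).map τ.toL2).topologicalClosure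

open Classical in
/-- The `τ`-preserving conditional expectation `E_A : M → A`: `E_A(x)` is the unique element of `A`
with `τ(E_A(x) a) = τ(x a)` for all `a ∈ A`. -/
def condExp (τ : FaithfulNormalTrace M) (A : VonNeumannAlgebra H) (x : Elem M) : Elem M :=
  if h : ∃ y : Elem M, (y : H →L[ℂ] H) ∈ A ∧
      ∀ a : Elem M, (a : H →L[ℂ] H) ∈ A → τ (y * a) = τ (x * a)
  then h.choose else 0

theorem condExp_eq (τ : FaithfulNormalTrace M) (A : VonNeumannAlgebra H) (x y : Elem M)
    (hy : (y : H →L[ℂ] H) ∈ A)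
    (h : ∀ a : Elem M, (a : H →L[ℂ] H) ∈ A → τ (y * a) = τ (x * a)) : τ.condExp A x = y := by
  have hex : ∃ y : Elem M, (y : H →L[ℂ] H) ∈ A ∧
      ∀ a : Elem M, (a : H →L[ℂ] H) ∈ A → τ (y * a) = τ (x * a) := ⟨y, hy, h⟩
  rw [condExp, dif_pos hex]
  obtain ⟨h1, h2⟩ := hex.choose_spec
  set z := hex.choose
  have hd : ((z - y : Elem M) : H →L[ℂ] H) ∈ A := sub_mem h1 hy
  have hs : ((star (z - y) : Elem M) : H →L[ℂ] H) ∈ A := star_mem hd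
  refine sub_eq_zero.mp (τ.faithful _ ?_)
  rw [τ.tracial, sub_mul, map_sub, h2 _ hs, h _ hs, sub_self]

/-- `A` is mixing in `M`: for every sequence of unitaries `uₙ` of `A` which converges to `0` in the
weak operator topology, `‖E_A(a uₙ b) - E_A(a) uₙ E_A(b)‖₂ → 0` for all `a, b ∈ M`. -/
def IsMixing (τ : FaithfulNormalTrace M) (A : VonNeumannAlgebra H) : Prop :=
  ∀ w : ℕ → Elem M, (∀ n, w n ∈ unitary (Elem M)) → (∀ n, (w n : H →L[ℂ] H) ∈ A) →
    Tendsto (fun n => (ContinuousLinearMapWOT.ofCLM (w n : H →L[ℂ] H) : H →WOT[ℂ] H))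
      atTop (𝓝 0) →
    ∀ a b : Elem M, Tendsto
      (fun n => τ.norm₂ (τ.condExp A (a * w n * b) - τ.condExp A a * w n * τ.condExp A b))
      atTop (𝓝 0)

end FaithfulNormalTrace

/-- `A` is diffuse: it has no minimal projection, that is, every nonzero projection `p ∈ A`
dominates a projection `q ∈ A` other than `0` and `p`. -/
def IsDiffuse (A : VonNeumannAlgebra H) : Prop :=
  ∀ p ∈ A, IsStarProjection p → p ≠ 0 →
    ∃ q ∈ A, IsStarProjection q ∧ p * q = q ∧ q ≠ 0 ∧ q ≠ p

/-- The normalizer `{u ∈ U(M) : u A u* = A}` of `A` in `M`. -/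
def normalizer (M A : VonNeumannAlgebra H) : Set (H →L[ℂ] H) :=
  {w | w ∈ M ∧ w ∈ unitary (H →L[ℂ] H) ∧
    (fun x => w * x * star w) '' (A : Set (H →L[ℂ] H)) = (A : Set (H →L[ℂ] H))}

/-- `A` is singular in `M`: its normalizer is contained in `A`. -/
def IsSingular (M A : VonNeumannAlgebra H) : Prop :=
  normalizer M A ⊆ (A : Set (H →L[ℂ] H))

end FiniteVN

end

noncomputable section

namespace FiniteVN

universe u

variable {H : Type u} [NormedAddCommGroup H] [InnerProductSpace ℂ H] [CompleteSpace H]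

/-! ### Weak operator compactness of balls -/

/-! For fixed `a`, `b` the defect x ↦ E_A(axb) − E_A(a)xE_A(b) is bounded for the 2-norm, and the
summability makes it Hilbert–Schmidt on L²(A). Such an operator sends bounded weakly null sequences
to norm null ones (`tendsto_zero_of_summable_norm_sq`), and unitaries of A tending weakly to 0 form
such a sequence. This gives mixing for a, b in Y. Because the middle factor is unitary, the defect
is controlled by ‖a‖₂ and also by ‖b‖₂, so the limit extends to all of M.

For singularity, let u normalize A and let (w_n) be weakly null unitaries of A. Then u w_n u* lies
in A and is its own expectation, so mixing with a = u, b = u* forces ‖E_A(u)‖₂ ≥ 1 = ‖u‖₂, hence u =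
E_A(u). Diffuseness supplies (w_n) (`exists_unitary_tendsto_zero`): an extreme point a of the
self-adjoint contractions of A orthogonal to finitely many self-adjoint elements satisfies a² = 1,
since a nonzero 1 − a² would leave an infinite-dimensional room for perturbations.

As `condExp` has a default value, the expectation must be shown to exist (`exists_condExp`): it is
the point nearest to x in the ball of A of radius ‖x‖. -/

theorem exists_forall_tendsto_inner {ι : Type*} (U : Ultrafilter ι) (f : ι → H →L[ℂ] H) (C : ℝ)
    (hf : ∀ᶠ i in U, ‖f i‖ ≤ C) :
    ∃ a : H →L[ℂ] H, ‖a‖ ≤ C ∧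
      ∀ ξ η : H, Tendsto (fun i => ⟪η, f i ξ⟫_ℂ) U (𝓝 ⟪η, a ξ⟫_ℂ) := by
  have hC : 0 ≤ C := by
    obtain ⟨i, hi⟩ := hf.exists
    exact (norm_nonneg _).trans hi
  have hlim : ∀ ξ η : H, ∃ z : ℂ, ‖z‖ ≤ C * ‖ξ‖ * ‖η‖ ∧
      Tendsto (fun i => ⟪f i ξ, η⟫_ℂ) U (𝓝 z) := by
    intro ξ η
    have hb : ∀ᶠ i in U, ⟪f i ξ, η⟫_ℂ ∈ Metric.closedBall (0 : ℂ) (C * ‖ξ‖ * ‖η‖) := by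
      filter_upwards [hf] with i hi
      rw [mem_closedBall_zero_iff]
      refine (norm_inner_le_norm _ _).trans ?_
      gcongr
      exact ((f i).le_opNorm ξ).trans (by gcongr)
    obtain ⟨z, hz, hle⟩ := (isCompact_closedBall (0 : ℂ) (C * ‖ξ‖ * ‖η‖)).ultrafilter_le_nhds'
      (U.map fun i => ⟪f i ξ, η⟫_ℂ) hb
    exact ⟨z, mem_closedBall_zero_iff.mp hz, hle⟩
  choose B hB hBt using hlim
  let B' : H →ₗ⋆[ℂ] H →ₗ[ℂ] ℂ := LinearMap.mk₂'ₛₗ (starRingEnd ℂ) (RingHom.id ℂ) B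
    (fun x y z => tendsto_nhds_unique (hBt _ _)
      (by simpa [inner_add_left] using (hBt x z).add (hBt y z)))
    (fun c x z => tendsto_nhds_unique (hBt _ _)
      (by simpa [inner_smul_left, mul_comm] using (hBt x z).mul_const (starRingEnd ℂ c)))
    (fun x y z => tendsto_nhds_unique (hBt _ _)
      (by simpa [inner_add_right] using (hBt x y).add (hBt x z)))
    (fun c x z => tendsto_nhds_unique (hBt _ _)
      (by simpa [inner_smul_right] using (hBt x z).const_mul c))
  -- The Riesz operator of the limit form. The form is conjugate-linear in its first variable, so ξ
  -- sits on the left here and the claim follows by conjugation.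
  let a := InnerProductSpace.continuousLinearMapOfBilin (LinearMap.mkContinuous₂ B' C hB)
  have ha : ∀ ξ η, ⟪a ξ, η⟫_ℂ = B ξ η := fun ξ η =>
    InnerProductSpace.continuousLinearMapOfBilin_apply _ ξ η
  refine ⟨a, a.opNorm_le_bound hC fun ξ => ?_, fun ξ η => ?_⟩
  · by_cases h0 : ‖a ξ‖ = 0
    · rw [h0]; positivity
    · have h1 := hB ξ (a ξ)
      rw [← ha, inner_self_eq_norm_sq_to_K, norm_pow] at h1
      simp only [Complex.coe_algebraMap, Complex.norm_real, norm_norm] at h1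
      have h2 : 0 < ‖a ξ‖ := lt_of_le_of_ne (norm_nonneg _) (Ne.symm h0)
      rw [pow_two] at h1
      exact le_of_mul_le_mul_right h1 h2
  · have h := (Complex.continuous_conj.tendsto _).comp (hBt ξ η)
    rw [← ha] at h
    simpa [Function.comp_def] using h

/-- By A = A'' it suffices to commute with each y in A'; that relation survives weak limits once y
is moved onto the test vector as an adjoint. -/
theorem mem_of_tendsto_inner {ι : Type*} {l : Filter ι} [l.NeBot] (A : VonNeumannAlgebra H)
    {f : ι → H →L[ℂ] H} {a : H →L[ℂ] H} (hf : ∀ᶠ i in l, f i ∈ A)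
    (h : ∀ ξ η : H, Tendsto (fun i => ⟪η, f i ξ⟫_ℂ) l (𝓝 ⟪η, a ξ⟫_ℂ)) : a ∈ A := by
  rw [← A.commutant_commutant, VonNeumannAlgebra.mem_commutant_iff]
  intro y hy
  rw [VonNeumannAlgebra.mem_commutant_iff] at hy
  ext ξ
  refine ext_inner_left ℂ fun η => ?_
  have h1 := h ξ (ContinuousLinearMap.adjoint y η)
  have h2 := h (y ξ) η
  simp only [ContinuousLinearMap.adjoint_inner_left] at h1
  refine tendsto_nhds_unique_of_eventuallyEq h1 h2 ?_
  filter_upwards [hf] with i hi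
  have := congrArg (fun T : H →L[ℂ] H => T ξ) (hy _ hi)
  simp only [mul_apply_eq_comp] at this
  rw [this]

namespace FaithfulNormalTrace

variable {M : VonNeumannAlgebra H} (τ : FaithfulNormalTrace M)

/-- Normality makes τ(y ·) an absolutely convergent sum of vector functionals; the uniform norm
bound then allows dominated convergence. -/
theorem tendsto_mul_of_tendsto_inner {ι : Type*} {l : Filter ι} {f : ι → Elem M} {a : Elem M}
    {C : ℝ} (hf : ∀ᶠ i in l, ‖(f i : H →L[ℂ] H)‖ ≤ C)
    (h : ∀ ξ η : H, Tendsto (fun i => ⟪η, (f i : H →L[ℂ] H) ξ⟫_ℂ) l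
      (𝓝 ⟪η, (a : H →L[ℂ] H) ξ⟫_ℂ)) (y : Elem M) :
    Tendsto (fun i => τ (y * f i)) l (𝓝 (τ (y * a))) := by
  obtain ⟨ξ, η, hξ, hη, hs⟩ := τ.normal
  have e : ∀ x : Elem M, τ (y * x) =
      ∑' i, ⟪ContinuousLinearMap.adjoint (y : H →L[ℂ] H) (η i), (x : H →L[ℂ] H) (ξ i)⟫_ℂ := by
    intro x
    rw [← (hs (y * x)).tsum_eq]
    simp [ContinuousLinearMap.adjoint_inner_left]
  simp only [e]
  refine tendsto_tsum_of_dominated_convergence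
    (bound := fun i => ‖(y : H →L[ℂ] H)‖ * C * (‖η i‖ ^ 2 + ‖ξ i‖ ^ 2))
    ((hη.add hξ).mul_left _) (fun k => h _ _) ?_
  filter_upwards [hf] with i hi k
  have hC : 0 ≤ C := (norm_nonneg _).trans hi
  calc _ ≤ ‖ContinuousLinearMap.adjoint (y : H →L[ℂ] H) (η k)‖ * ‖(f i : H →L[ℂ] H) (ξ k)‖ :=
        norm_inner_le_norm _ _
    _ ≤ (‖(y : H →L[ℂ] H)‖ * ‖η k‖) * (C * ‖ξ k‖) := by
        gcongr
        · refine (ContinuousLinearMap.le_opNorm _ _).trans ?_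
          rw [LinearIsometryEquiv.norm_map]
        · exact ((f i : H →L[ℂ] H).le_opNorm _).trans (by gcongr)
    _ = ‖(y : H →L[ℂ] H)‖ * C * (‖η k‖ * ‖ξ k‖) := by ring
    _ ≤ _ := by
        gcongr
        nlinarith [sq_nonneg (‖η k‖ - ‖ξ k‖), sq_nonneg (‖η k‖), sq_nonneg (‖ξ k‖)]

/-- Along an ultrafilter, a bounded family in `A ⊆ M` has a limit in `A`, both in the weak operator
topology and for the functionals `τ(y ·)`. -/
theorem exists_ultrafilter_limit {A : VonNeumannAlgebra H} (hAM : A ≤ M) {ι : Type*}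
    (U : Ultrafilter ι) (f : ι → Elem M) (C : ℝ) (hfA : ∀ᶠ i in U, (f i : H →L[ℂ] H) ∈ A)
    (hf : ∀ᶠ i in U, ‖(f i : H →L[ℂ] H)‖ ≤ C) :
    ∃ a : Elem M, (a : H →L[ℂ] H) ∈ A ∧ ‖(a : H →L[ℂ] H)‖ ≤ C ∧
      (∀ ξ η : H, Tendsto (fun i => ⟪η, (f i : H →L[ℂ] H) ξ⟫_ℂ) U
        (𝓝 ⟪η, (a : H →L[ℂ] H) ξ⟫_ℂ)) ∧
      ∀ y : Elem M, Tendsto (fun i => τ (y * f i)) U (𝓝 (τ (y * a))) := by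
  obtain ⟨a, haC, hat⟩ := exists_forall_tendsto_inner U (fun i => (f i : H →L[ℂ] H)) C hf
  have haA := mem_of_tendsto_inner A hfA hat
  exact ⟨⟨a, hAM haA⟩, haA, haC, hat, τ.tendsto_mul_of_tendsto_inner hf hat⟩

/-! ### Elementary properties of the `2`-norm -/

theorem norm₂_star (x : Elem M) : τ.norm₂ (star x) = τ.norm₂ x := by
  rw [norm₂, norm₂, star_star, τ.tracial]

theorem norm₂_nonneg (x : Elem M) : 0 ≤ τ.norm₂ x := Real.sqrt_nonneg _

theorem norm₂_sq (x : Elem M) : ((τ.norm₂ x ^ 2 : ℝ) : ℂ) = τ (star x * x) := by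
  have h := τ.nonneg x
  rw [norm₂, Real.sq_sqrt (Complex.nonneg_iff.mp h).1]
  exact (Complex.eq_re_of_ofReal_le h).symm

theorem norm_trace_star_mul_le (x y : Elem M) : ‖τ (star x * y)‖ ≤ τ.norm₂ x * τ.norm₂ y := by
  rw [← inner_toL2, ← norm_toL2, ← norm_toL2]
  exact norm_inner_le_norm _ _

theorem toL2_injective : Function.Injective τ.toL2 := by
  rw [← LinearMap.ker_eq_bot, LinearMap.ker_eq_bot']
  intro x hx
  refine τ.faithful x ?_
  rw [← inner_toL2, hx, inner_zero_left]

theorem denseRange_toL2 : DenseRange τ.toL2 :=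
  UniformSpace.Completion.denseRange_coe (α := τ.PreL2)

end FaithfulNormalTrace

/-! ### Functional calculus in a von Neumann algebra -/

/-- Whatever commutes with `a` commutes with `cfc f a`. No continuity or self-adjointness is needed,
because the calculus is 0 by default. -/
theorem cfc_mem (A : VonNeumannAlgebra H) {a : H →L[ℂ] H} (ha : a ∈ A) (f : ℝ → ℝ) :
    cfc f a ∈ A := by
  rw [← A.commutant_commutant, VonNeumannAlgebra.mem_commutant_iff]
  intro y hy
  rw [VonNeumannAlgebra.mem_commutant_iff] at hy
  have hc : Commute a y := hy a ha
  exact ((hc.cfc_real f).eq).symm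

theorem exists_eq_star_mul_self (A : VonNeumannAlgebra H) {a : H →L[ℂ] H} (ha : a ∈ A)
    (h0 : 0 ≤ a) : ∃ k ∈ A, IsSelfAdjoint k ∧ a = k * k := by
  refine ⟨cfc Real.sqrt a, cfc_mem A ha _, cfc_predicate _ _, ?_⟩
  rw [← cfc_mul ..]
  conv_lhs => rw [← cfc_id ℝ a]
  refine cfc_congr fun x hx => ?_
  exact (Real.mul_self_sqrt (spectrum_nonneg_of_nonneg h0 hx)).symm

/-! ### Positivity of the trace and operator-norm bounds for the 2-norm -/

namespace FaithfulNormalTrace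

variable {M : VonNeumannAlgebra H} (τ : FaithfulNormalTrace M)

theorem trace_nonneg {x : Elem M} (hx : 0 ≤ (x : H →L[ℂ] H)) : 0 ≤ τ x := by
  obtain ⟨k, hk, hks, e⟩ := exists_eq_star_mul_self M x.2 hx
  have : x = star (⟨k, hk⟩ : Elem M) * ⟨k, hk⟩ := by
    apply Subtype.ext
    simp [e, hks.star_eq]
  rw [this]
  exact τ.nonneg _

theorem trace_mono {x y : Elem M} (h : (x : H →L[ℂ] H) ≤ y) : (τ x).re ≤ (τ y).re := by
  have := (Complex.nonneg_iff.mp (τ.trace_nonneg (x := y - x) (by simpa using h))).1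
  rw [map_sub, Complex.sub_re] at this
  linarith

theorem norm₂_mul_le_left (x y : Elem M) :
    τ.norm₂ (x * y) ≤ ‖(x : H →L[ℂ] H)‖ * τ.norm₂ y := by
  have h : (τ (star (x * y) * (x * y))).re ≤
      (τ (star ((‖(x : H →L[ℂ] H)‖ : ℂ) • y) * ((‖(x : H →L[ℂ] H)‖ : ℂ) • y))).re := by
    apply τ.trace_mono
    have := CStarAlgebra.star_left_conjugate_le_norm_smul (a := (y : H →L[ℂ] H))
      (b := star (x : H →L[ℂ] H) * x) (.star_mul_self _)
    rw [CStarRing.norm_star_mul_self] at this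
    refine le_trans (le_of_eq ?_) (this.trans (le_of_eq ?_))
    · simp [mul_assoc]
    · simp [smul_smul]
  have h2 := Real.sqrt_le_sqrt h
  refine h2.trans (le_of_eq ?_)
  rw [← norm₂, ← norm_toL2, map_smul, norm_smul, norm_toL2]
  simp

theorem norm₂_mul_le_right (x y : Elem M) :
    τ.norm₂ (x * y) ≤ τ.norm₂ x * ‖(y : H →L[ℂ] H)‖ := by
  rw [← norm₂_star, star_mul, ← norm₂_star τ x, mul_comm]
  refine (τ.norm₂_mul_le_left _ _).trans (le_of_eq ?_)
  simp

/-- With r = k², Cauchy–Schwarz bounds |τ(kxk)| by ‖k‖₂‖xk‖₂ ≤ ‖x‖‖k‖₂², and ‖k‖₂² = τ(r). -/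
theorem norm_trace_mul_le {x r : Elem M} (hr : 0 ≤ (r : H →L[ℂ] H)) :
    ‖τ (x * r)‖ ≤ ‖(x : H →L[ℂ] H)‖ * (τ r).re := by
  obtain ⟨k, hk, hks, e⟩ := exists_eq_star_mul_self M r.2 hr
  set k' : Elem M := ⟨k, hk⟩
  have hk' : star k' = k' := Subtype.ext hks
  have e' : r = k' * k' := Subtype.ext e
  have h1 : (τ r).re = τ.norm₂ k' ^ 2 := by
    rw [← Complex.ofReal_re (τ.norm₂ k' ^ 2), norm₂_sq, hk', e']
  rw [h1, e', ← mul_assoc, τ.tracial, ← hk', pow_two, mul_left_comm]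
  refine (τ.norm_trace_star_mul_le _ _).trans ?_
  rw [hk']
  gcongr
  · exact norm₂_nonneg _ _
  · exact norm₂_mul_le_left _ _ _

theorem norm₂_unitary_mul {w : Elem M} (hw : w ∈ unitary (Elem M)) (x : Elem M) :
    τ.norm₂ (w * x) = τ.norm₂ x := by
  rw [norm₂, norm₂, star_mul, mul_assoc, ← mul_assoc (star w), (Unitary.mem_iff.mp hw).1, one_mul]

theorem norm₂_mul_unitary {w : Elem M} (hw : w ∈ unitary (Elem M)) (x : Elem M) :
    τ.norm₂ (x * w) = τ.norm₂ x := by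
  rw [← norm₂_star, star_mul, τ.norm₂_unitary_mul (Unitary.star_mem hw), norm₂_star]

end FaithfulNormalTrace

/-! ### The conditional expectation -/

/-- An approximate polar decomposition inside a von Neumann algebra. -/
theorem exists_approx_polar (A : VonNeumannAlgebra H) {h : H →L[ℂ] H} (hh : h ∈ A) {δ : ℝ}
    (hδ : 0 < δ) : ∃ u ∈ A, ∃ r ∈ A, ‖u‖ ≤ 1 ∧ 0 ≤ r ∧ h = u * r ∧
      r - (δ : ℂ) • (1 : H →L[ℂ] H) ≤ star h * u := by
  set s : H →L[ℂ] H := star h * h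
  have hs : IsSelfAdjoint s := .star_mul_self h
  have hs0 : 0 ≤ s := star_mul_self_nonneg h
  have hsA : s ∈ A := mul_mem (star_mem hh) hh
  have hpos : ∀ t ∈ spectrum ℝ s, 0 < t + δ ^ 2 := fun t ht => by
    have := spectrum_nonneg_of_nonneg hs0 ht
    positivity
  have hsq : ∀ t ∈ spectrum ℝ s, √(t + δ ^ 2) ≠ 0 := fun t ht =>
    (Real.sqrt_pos.mpr (hpos t ht)).ne'
  -- The shift by δ² makes the modulus f(s) invertible, with inverse g(s). The final inequality is
  -- √(t + δ²) − δ ≤ t/√(t + δ²).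
  set f : ℝ → ℝ := fun t => √(t + δ ^ 2)
  set g : ℝ → ℝ := fun t => (√(t + δ ^ 2))⁻¹
  have hf : ContinuousOn f (spectrum ℝ s) := by fun_prop
  have hg : ContinuousOn g (spectrum ℝ s) := hf.inv₀ hsq
  have hid : ContinuousOn (fun t : ℝ => t) (spectrum ℝ s) := by fun_prop
  have hsid : s = cfc (fun t : ℝ => t) s := (cfc_id' ℝ s).symm
  have hgf : cfc g s * cfc f s = 1 := by
    rw [← cfc_mul g f s, ← cfc_one ℝ s]
    exact cfc_congr fun t ht => inv_mul_cancel₀ (hsq t ht)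
  have hgs : star (cfc g s) = cfc g s := (cfc_predicate g s : IsSelfAdjoint _)
  refine ⟨h * cfc g s, mul_mem hh (cfc_mem A hsA g), cfc f s, cfc_mem A hsA f, ?_, ?_, ?_, ?_⟩
  · have e : star (h * cfc g s) * (h * cfc g s) = cfc (fun t => g t * (t * g t)) s := by
      rw [cfc_mul g (fun t => t * g t) s hg (hid.mul hg), cfc_mul (fun t => t) g s, ← hsid,
        star_mul, hgs]
      simp only [s, mul_assoc]
    have h1 : ‖star (h * cfc g s) * (h * cfc g s)‖ ≤ 1 := by
      rw [e]
      refine norm_cfc_le zero_le_one fun t ht => ?_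
      have h0 := spectrum_nonneg_of_nonneg hs0 ht
      have hp := hpos t ht
      have e2 : g t * (t * g t) = t / (t + δ ^ 2) := by
        have : g t * g t = (t + δ ^ 2)⁻¹ := by
          simp only [g]
          rw [← mul_inv, Real.mul_self_sqrt hp.le]
        rw [mul_left_comm, this, div_eq_mul_inv]
      rw [e2, Real.norm_of_nonneg (by positivity), div_le_one hp]
      nlinarith
    rw [CStarRing.norm_star_mul_self] at h1
    nlinarith [norm_nonneg (h * cfc g s)]
  · exact cfc_nonneg fun t _ => Real.sqrt_nonneg _
  · rw [mul_assoc, hgf, mul_one]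
  · have e1 : star h * (h * cfc g s) = cfc (fun t => t * g t) s := by
      rw [cfc_mul (fun t => t) g s, ← hsid, ← mul_assoc]
    have e2 : cfc f s - (δ : ℂ) • (1 : H →L[ℂ] H) = cfc (fun t => f t - δ) s := by
      rw [cfc_sub f (fun _ => δ) s, cfc_const δ s, Algebra.algebraMap_eq_smul_one]
      rfl
    rw [e1, e2]
    refine cfc_mono (fun t ht => ?_) (by fun_prop) (hid.mul hg)
    have hp := hpos t ht
    have h0 := spectrum_nonneg_of_nonneg hs0 ht
    have hq : 0 < √(t + δ ^ 2) := Real.sqrt_pos.mpr hp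
    have hm := Real.mul_self_sqrt hp.le
    have hge : δ ≤ √(t + δ ^ 2) := Real.le_sqrt_of_sq_le (by linarith)
    simp only [f, g]
    rw [← div_eq_mul_inv, le_div_iff₀ hq]
    nlinarith

/-- The nearest point of a complete convex set, for complex scalars. -/
theorem exists_forall_re_inner_sub_nonpos {E : Type*} [NormedAddCommGroup E]
    [InnerProductSpace ℂ E] {K : Set E} (hne : K.Nonempty) (hc : IsComplete K)
    (hconv : ∀ x ∈ K, ∀ y ∈ K, ∀ s t : ℝ, 0 ≤ s → 0 ≤ t → s + t = 1 →
      (s : ℂ) • x + (t : ℂ) • y ∈ K) (x : E) :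
    ∃ p ∈ K, ∀ w ∈ K, (⟪x - p, w - p⟫_ℂ).re ≤ 0 := by
  let : InnerProductSpace ℝ E := InnerProductSpace.rclikeToReal ℂ E
  have hK : Convex ℝ K := fun a ha b hb s t hs ht hst => hconv a ha b hb s t hs ht hst
  obtain ⟨p, hpK, hp⟩ := exists_norm_eq_iInf_of_complete_convex hne hc hK x
  exact ⟨p, hpK, (norm_eq_iInf_iff_real_inner_le_zero hK hpK).mp hp⟩

namespace FaithfulNormalTrace

variable {M : VonNeumannAlgebra H} (τ : FaithfulNormalTrace M)

theorem norm₂_le_norm (x : Elem M) : τ.norm₂ x ≤ ‖(x : H →L[ℂ] H)‖ := by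
  have h := τ.norm₂_mul_le_left x 1
  have h1 : τ.norm₂ 1 = 1 := by simp [norm₂, τ.map_one]
  rwa [mul_one, h1, mul_one] at h

/-- Duality: w = ‖x‖u, with u an approximate polar part of h, nearly maximizes Re τ(h* ·) on the
ball of A, while Re τ(h*x) ≤ ‖x‖τ(r). -/
theorem exists_re_trace_le {A : VonNeumannAlgebra H} (hAM : A ≤ M) (x h : Elem M)
    (hh : (h : H →L[ℂ] H) ∈ A) {ε : ℝ} (hε : 0 < ε) :
    ∃ w : Elem M, (w : H →L[ℂ] H) ∈ A ∧ ‖(w : H →L[ℂ] H)‖ ≤ ‖(x : H →L[ℂ] H)‖ ∧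
      (τ (star h * (x - w))).re ≤ ε := by
  set C := ‖(x : H →L[ℂ] H)‖
  have hC : 0 ≤ C := norm_nonneg _
  obtain ⟨u, hu, r, hr, hu1, hr0, hur, hle⟩ :=
    exists_approx_polar A hh (δ := ε / (C + 1)) (by positivity)
  set u' : Elem M := ⟨u, hAM hu⟩
  set r' : Elem M := ⟨r, hAM hr⟩
  have hur' : h = u' * r' := Subtype.ext hur
  have hrs : star r' = r' := Subtype.ext (IsSelfAdjoint.of_nonneg hr0).star_eq
  refine ⟨(C : ℂ) • u', A.toStarSubalgebra.smul_mem hu _, ?_, ?_⟩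
  · have : ‖((C : ℂ) • u : H →L[ℂ] H)‖ ≤ C := by
      rw [norm_smul, Complex.norm_real, Real.norm_of_nonneg hC]
      exact mul_le_of_le_one_right hC hu1
    exact this
  · have h1 : (τ (star h * x)).re ≤ C * (τ r').re := by
      have e : τ (star h * x) = τ (star u' * x * r') := by
        rw [hur', star_mul, hrs, mul_assoc, τ.tracial]
      rw [e]
      refine (Complex.re_le_norm _).trans ((τ.norm_trace_mul_le hr0).trans ?_)
      have hr1 : 0 ≤ (τ r').re := (Complex.nonneg_iff.mp (τ.trace_nonneg (x := r') hr0)).1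
      gcongr
      refine (norm_mul_le (star u) (x : H →L[ℂ] H)).trans ?_
      rw [norm_star]
      exact mul_le_of_le_one_left hC hu1
    have h2 : (τ r').re - ε / (C + 1) ≤ (τ (star h * u')).re := by
      have := τ.trace_mono (x := r' - ((ε / (C + 1) : ℝ) : ℂ) • (1 : Elem M))
        (y := star h * u') hle
      rw [map_sub, map_smul, τ.map_one, Complex.sub_re] at this
      rw [smul_eq_mul, mul_one, Complex.ofReal_re] at this
      linarith
    rw [mul_sub, map_sub, Complex.sub_re, mul_smul_comm, map_smul, smul_eq_mul,
      Complex.re_ofReal_mul]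
    have h3 : C * (ε / (C + 1)) ≤ ε := by
      rw [← mul_div_assoc, div_le_iff₀ (by positivity)]
      nlinarith
    nlinarith [mul_le_mul_of_nonneg_left h2 hC]

/-- The image in `L²(M)` of the ball of radius `C` of `A`. -/
def l2Ball (A : VonNeumannAlgebra H) (C : ℝ) : Set τ.L2 :=
  τ.toL2 '' {a | (a : H →L[ℂ] H) ∈ A ∧ ‖(a : H →L[ℂ] H)‖ ≤ C}

/-- An L² limit of elements of the ball equals their weak operator limit, as seen by pairing with
the dense image of M; so it is again an operator in the ball. -/
theorem isClosed_l2Ball {A : VonNeumannAlgebra H} (hAM : A ≤ M) (C : ℝ) :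
    IsClosed (τ.l2Ball A C) := by
  rw [isClosed_iff_ultrafilter]
  intro x U hU hmem
  set V := Ultrafilter.ofComapInfPrincipal hmem
  have hV := Ultrafilter.ofComapInfPrincipal_mem hmem
  have hVU : V.map τ.toL2 = U := Ultrafilter.ofComapInfPrincipal_eq_of_map hmem
  obtain ⟨a, haA, haC, -, hat⟩ := τ.exists_ultrafilter_limit hAM V id C
    (Filter.mem_of_superset hV fun a ha => ha.1) (Filter.mem_of_superset hV fun a ha => ha.2)
  have hx : Tendsto τ.toL2 V (𝓝 x) := by
    have : (V.map τ.toL2 : Filter τ.L2) ≤ 𝓝 x := by rw [hVU]; exact hU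
    exact this
  refine ⟨a, ⟨haA, haC⟩, ?_⟩
  refine τ.denseRange_toL2.eq_of_inner_right ℂ fun y => ?_
  have h1 : Tendsto (fun i => ⟪τ.toL2 y, τ.toL2 i⟫_ℂ) V (𝓝 ⟪τ.toL2 y, x⟫_ℂ) :=
    tendsto_const_nhds.inner hx
  have h2 := hat (star y)
  simp only [← inner_toL2, id] at h2
  exact tendsto_nhds_unique h2 h1

theorem smul_add_smul_mem_l2Ball (A : VonNeumannAlgebra H) (C : ℝ) :
    ∀ x ∈ τ.l2Ball A C, ∀ y ∈ τ.l2Ball A C, ∀ s t : ℝ, 0 ≤ s → 0 ≤ t → s + t = 1 →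
      (s : ℂ) • x + (t : ℂ) • y ∈ τ.l2Ball A C := by
  rintro _ ⟨a, ⟨ha, haC⟩, rfl⟩ _ ⟨b, ⟨hb, hbC⟩, rfl⟩ s t hs ht hst
  refine ⟨(s : ℂ) • a + (t : ℂ) • b, ⟨?_, ?_⟩, ?_⟩
  · exact A.toStarSubalgebra.add_mem (A.toStarSubalgebra.smul_mem ha _)
      (A.toStarSubalgebra.smul_mem hb _)
  · calc ‖((s : ℂ) • (a : H →L[ℂ] H) + (t : ℂ) • (b : H →L[ℂ] H))‖
        ≤ s * C + t * C := by
          refine (norm_add_le _ _).trans ?_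
          rw [norm_smul, norm_smul, Complex.norm_real, Complex.norm_real,
            Real.norm_of_nonneg hs, Real.norm_of_nonneg ht]
          gcongr
      _ = C := by rw [← add_mul, hst, one_mul]
  · rw [map_add, map_smul, map_smul]

theorem toL2_mem_L2Sub {A : VonNeumannAlgebra H} {a : Elem M} (ha : (a : H →L[ℂ] H) ∈ A) :
    τ.toL2 a ∈ τ.L2Sub A :=
  Submodule.le_topologicalClosure _ ⟨a, ha, rfl⟩

theorem exists_condExp {A : VonNeumannAlgebra H} (hAM : A ≤ M) (x : Elem M) :
    ∃ y : Elem M, (y : H →L[ℂ] H) ∈ A ∧ ‖(y : H →L[ℂ] H)‖ ≤ ‖(x : H →L[ℂ] H)‖ ∧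
      ∀ a : Elem M, (a : H →L[ℂ] H) ∈ A → τ (y * a) = τ (x * a) := by
  set C := ‖(x : H →L[ℂ] H)‖
  have hne : (τ.l2Ball A C).Nonempty :=
    ⟨_, 0, ⟨A.toStarSubalgebra.zero_mem, by simp [C]⟩, rfl⟩
  obtain ⟨p, hpK, hp⟩ := exists_forall_re_inner_sub_nonpos hne
    (τ.isClosed_l2Ball hAM C).isComplete (τ.smul_add_smul_mem_l2Ball A C) (τ.toL2 x)
  obtain ⟨y, ⟨hyA, hyC⟩, rfl⟩ := hpK
  refine ⟨y, hyA, hyC, ?_⟩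
  set ζ := τ.toL2 x - τ.toL2 y
  have hcl : IsClosed (τ.L2Sub A : Set τ.L2) := Submodule.isClosed_topologicalClosure _
  have : CompleteSpace (τ.L2Sub A) := hcl.completeSpace_coe
  -- The goal amounts to x − y ⊥ A, that is, η = 0.
  set η : τ.L2 := (τ.L2Sub A).starProjection ζ
  have hηmem : η ∈ τ.L2Sub A := Submodule.starProjection_apply_mem _ _
  have hηζ : ∀ z ∈ τ.L2Sub A, ⟪η, z⟫_ℂ = ⟪ζ, z⟫_ℂ := by
    intro z hz
    have := Submodule.starProjection_inner_eq_zero (K := τ.L2Sub A) ζ z hz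
    rw [inner_sub_left, sub_eq_zero] at this
    exact this.symm
  have hη0 : ‖η‖ ^ 2 ≤ 0 := by
    refine le_of_forall_pos_le_add fun ε hε => ?_
    rw [zero_add]
    set δ := ε / (2 * C + 1)
    have hC : 0 ≤ C := norm_nonneg _
    have hδ : 0 < δ := by positivity
    obtain ⟨_, ⟨h, hh, rfl⟩, hhη⟩ := Metric.mem_closure_iff.mp hηmem δ hδ
    obtain ⟨w, hwA, hwC, hw⟩ := τ.exists_re_trace_le hAM x h hh hδ
    -- The three terms are small in turn because h approximates η, by the choice of w, and by the
    -- variational inequality at the nearest point y.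
    have e1 : ‖η‖ ^ 2 = (⟪η - τ.toL2 h, τ.toL2 (x - w)⟫_ℂ).re + (τ (star h * (x - w))).re
        + (⟪ζ, τ.toL2 w - τ.toL2 y⟫_ℂ).re := by
      have e2 : ⟪ζ, η⟫_ℂ = ⟪η, ζ⟫_ℂ := by
        rw [← inner_conj_symm η ζ, ← hηζ η hηmem, inner_conj_symm]
      rw [← inner_toL2, ← Complex.add_re, ← inner_add_left, sub_add_cancel,
        ← hηζ _ ((τ.L2Sub A).sub_mem (τ.toL2_mem_L2Sub hwA) (τ.toL2_mem_L2Sub hyA)),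
        ← Complex.add_re, ← inner_add_right, map_sub, sub_add_sub_cancel, ← e2,
        ← hηζ η hηmem, inner_self_eq_norm_sq_to_K]
      simp [← Complex.ofReal_pow]
    have h3 : (⟪ζ, τ.toL2 w - τ.toL2 y⟫_ℂ).re ≤ 0 := hp _ ⟨w, ⟨hwA, hwC⟩, rfl⟩
    have h4 : (⟪η - τ.toL2 h, τ.toL2 (x - w)⟫_ℂ).re ≤ δ * (2 * C) := by
      refine (Complex.re_le_norm _).trans ((norm_inner_le_norm _ _).trans ?_)
      rw [dist_eq_norm] at hhη
      refine mul_le_mul hhη.le ?_ (norm_nonneg _) hδ.le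
      rw [norm_toL2]
      refine (τ.norm₂_le_norm _).trans ((norm_sub_le (x : H →L[ℂ] H) w).trans ?_)
      linarith
    have h5 : δ * (2 * C + 1) = ε := by
      simp only [δ]; field_simp
    linarith
  have hη0' : η = 0 := by
    have := pow_eq_zero_iff (two_ne_zero) |>.mp (le_antisymm hη0 (sq_nonneg _))
    exact norm_eq_zero.mp this
  intro a ha
  have hsa : ((star a : Elem M) : H →L[ℂ] H) ∈ A := star_mem (s := A) ha
  have h6 := hηζ _ (τ.toL2_mem_L2Sub hsa)
  rw [hη0', inner_zero_left] at h6
  simp only [ζ] at h6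
  rw [← map_sub, inner_toL2, ← star_mul, τ.map_star] at h6
  have h7 : τ (a * (x - y)) = 0 := by
    have := congrArg (starRingEnd ℂ) h6
    rw [map_zero, Complex.conj_conj] at this
    exact this.symm
  rw [τ.tracial y, τ.tracial x, ← sub_eq_zero, ← map_sub, ← mul_sub, ← neg_sub x y, mul_neg,
    map_neg, h7, neg_zero]

end FaithfulNormalTrace

/-! ### A Hilbert–Schmidt argument -/

section HilbertSchmidt

variable {E G : Type*} [NormedAddCommGroup E] [InnerProductSpace ℂ E] [NormedAddCommGroup G]
  [NormedSpace ℂ G]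

/-- Outside a finite set, Cauchy–Schwarz and Bessel bound the tail by ‖x‖ times the square root of
the tail of Σ‖T vₙ‖². Finite combinations suffice, as the estimate is a closed condition. -/
theorem exists_finset_norm_sub_sum_le {v : ℕ → E} (hv : Orthonormal ℂ v) (T : E →L[ℂ] G)
    (hT : Summable fun n => ‖T (v n)‖ ^ 2) {δ : ℝ} (hδ : 0 < δ) :
    ∃ s : Finset ℕ, ∀ x ∈ (Submodule.span ℂ (Set.range v)).topologicalClosure,
      ‖T x - ∑ n ∈ s, ⟪v n, x⟫_ℂ • T (v n)‖ ≤ δ * ‖x‖ := by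
  obtain ⟨s, hs⟩ := summable_iff_vanishing_norm.mp hT (δ ^ 2) (by positivity)
  refine ⟨s, fun x hx => ?_⟩
  have hclosed : IsClosed {x : E | ‖T x - ∑ n ∈ s, ⟪v n, x⟫_ℂ • T (v n)‖ ≤ δ * ‖x‖} :=
    isClosed_le (by fun_prop) (by fun_prop)
  refine closure_minimal ?_ hclosed hx
  intro x hx
  obtain ⟨l, hl⟩ := Finsupp.mem_span_range_iff_exists_finsupp.mp hx
  set t := l.support ∪ s
  have hx' : x = ∑ n ∈ t, l n • v n := by
    rw [← hl]
    exact Finsupp.sum_of_support_subset _ Finset.subset_union_left _ (by simp)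
  have hst : s ⊆ t := Finset.subset_union_right
  have hin : ∀ n ∈ t, ⟪v n, x⟫_ℂ = l n := fun n hn => by
    rw [hx']; exact hv.inner_right_sum (⇑l) hn
  have e : T x - ∑ n ∈ s, ⟪v n, x⟫_ℂ • T (v n) = ∑ n ∈ t \ s, l n • T (v n) := by
    have e0 : ∑ n ∈ s, ⟪v n, x⟫_ℂ • T (v n) = ∑ n ∈ s, l n • T (v n) :=
      Finset.sum_congr rfl fun n hn => by rw [hin n (hst hn)]
    rw [e0, sub_eq_iff_eq_add, Finset.sum_sdiff hst]
    conv_lhs => rw [hx']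
    simp
  have h1 : ∑ n ∈ t \ s, ‖l n‖ ^ 2 ≤ ‖x‖ ^ 2 := by
    refine le_trans (le_of_eq (Finset.sum_congr rfl fun n hn => ?_))
      (hv.sum_inner_products_le (s := t \ s) x)
    rw [hin n (Finset.sdiff_subset hn)]
  have h2 : ∑ n ∈ t \ s, ‖T (v n)‖ ^ 2 ≤ δ ^ 2 :=
    (Real.le_norm_self _).trans (hs _ Finset.sdiff_disjoint).le
  change ‖_‖ ≤ _
  rw [e]
  calc ‖∑ n ∈ t \ s, l n • T (v n)‖ ≤ ∑ n ∈ t \ s, ‖l n‖ * ‖T (v n)‖ :=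
        norm_sum_le_of_le _ fun n _ => (norm_smul _ _).le
    _ ≤ √(∑ n ∈ t \ s, ‖l n‖ ^ 2) * √(∑ n ∈ t \ s, ‖T (v n)‖ ^ 2) :=
        Real.sum_mul_le_sqrt_mul_sqrt _ _ _
    _ ≤ √(‖x‖ ^ 2) * √(δ ^ 2) := by gcongr
    _ = δ * ‖x‖ := by
        rw [Real.sqrt_sq (norm_nonneg _), Real.sqrt_sq hδ.le, mul_comm]

theorem tendsto_zero_of_summable_norm_sq {v : ℕ → E} (hv : Orthonormal ℂ v) (T : E →L[ℂ] G)
    (hT : Summable fun n => ‖T (v n)‖ ^ 2) {x : ℕ → E} {C : ℝ} (hC : ∀ k, ‖x k‖ ≤ C)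
    (hx : ∀ k, x k ∈ (Submodule.span ℂ (Set.range v)).topologicalClosure)
    (h0 : ∀ n, Tendsto (fun k => ⟪v n, x k⟫_ℂ) atTop (𝓝 0)) :
    Tendsto (fun k => ‖T (x k)‖) atTop (𝓝 0) := by
  have hC0 : 0 ≤ C := (norm_nonneg _).trans (hC 0)
  rw [Metric.tendsto_atTop]
  intro ε hε
  obtain ⟨s, hs⟩ := exists_finset_norm_sub_sum_le hv T hT
    (δ := ε / 2 / (C + 1)) (by positivity)
  have hlim : Tendsto (fun k => ∑ n ∈ s, ⟪v n, x k⟫_ℂ • T (v n)) atTop (𝓝 0) := by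
    have := tendsto_finsetSum s fun n _ => (h0 n).smul_const (T (v n))
    simpa using this
  obtain ⟨N, hN⟩ := Metric.tendsto_atTop.mp hlim (ε / 2) (by positivity)
  refine ⟨N, fun k hk => ?_⟩
  have h1 := hN k hk
  have h2 := hs (x k) (hx k)
  rw [dist_zero_right] at h1
  rw [dist_zero_right, norm_norm]
  have h3 : ε / 2 / (C + 1) * ‖x k‖ ≤ ε / 2 := by
    rw [div_mul_eq_mul_div, div_le_iff₀ (by positivity)]
    have := hC k
    gcongr
    linarith
  have h4 := norm_le_norm_sub_add (T (x k)) (∑ n ∈ s, ⟪v n, x k⟫_ℂ • T (v n))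
  linarith

end HilbertSchmidt

theorem norm_le_one_of_star_mul_self_eq_one {w : H →L[ℂ] H} (hw : star w * w = 1) : ‖w‖ ≤ 1 := by
  have h : ‖w‖ * ‖w‖ ≤ 1 := by
    rw [← CStarRing.norm_star_mul_self, hw]
    exact ContinuousLinearMap.norm_id_le
  nlinarith [norm_nonneg w]

/-! ### Properties of the conditional expectation -/

namespace FaithfulNormalTrace

variable {M : VonNeumannAlgebra H} (τ : FaithfulNormalTrace M) {A : VonNeumannAlgebra H}

theorem condExp_spec (hAM : A ≤ M) (x : Elem M) :
    (τ.condExp A x : H →L[ℂ] H) ∈ A ∧ ‖(τ.condExp A x : H →L[ℂ] H)‖ ≤ ‖(x : H →L[ℂ] H)‖ ∧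
      ∀ a : Elem M, (a : H →L[ℂ] H) ∈ A → τ (τ.condExp A x * a) = τ (x * a) := by
  obtain ⟨y, hy, hyx, h⟩ := τ.exists_condExp hAM x
  rw [τ.condExp_eq A x y hy h]
  exact ⟨hy, hyx, h⟩

theorem condExp_of_mem {x : Elem M} (hx : (x : H →L[ℂ] H) ∈ A) : τ.condExp A x = x :=
  τ.condExp_eq A x x hx fun _ _ => rfl

theorem condExp_add (hAM : A ≤ M) (x y : Elem M) :
    τ.condExp A (x + y) = τ.condExp A x + τ.condExp A y := by
  obtain ⟨hx, -, hx'⟩ := τ.condExp_spec hAM x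
  obtain ⟨hy, -, hy'⟩ := τ.condExp_spec hAM y
  refine τ.condExp_eq A _ _ (A.toStarSubalgebra.add_mem hx hy) fun a ha => ?_
  rw [add_mul, add_mul, map_add, map_add, hx' a ha, hy' a ha]

theorem condExp_smul (hAM : A ≤ M) (c : ℂ) (x : Elem M) :
    τ.condExp A (c • x) = c • τ.condExp A x := by
  obtain ⟨hx, -, hx'⟩ := τ.condExp_spec hAM x
  refine τ.condExp_eq A _ _ (A.toStarSubalgebra.smul_mem hx c) fun a ha => ?_
  rw [smul_mul_assoc, smul_mul_assoc, map_smul, map_smul, hx' a ha]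

/-- Pythagoras: x − E_A(x) is orthogonal to E_A(x). -/
theorem norm₂_sub_condExp_sq (hAM : A ≤ M) (x : Elem M) :
    τ.norm₂ (x - τ.condExp A x) ^ 2 = τ.norm₂ x ^ 2 - τ.norm₂ (τ.condExp A x) ^ 2 := by
  obtain ⟨hx, -, hx'⟩ := τ.condExp_spec hAM x
  have h1 := hx' (star (τ.condExp A x)) (star_mem (s := A) hx)
  rw [τ.tracial, τ.tracial x] at h1
  have h2 := congrArg (starRingEnd ℂ) h1
  rw [← τ.map_star, ← τ.map_star, star_mul, star_mul, star_star] at h2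
  apply Complex.ofReal_injective
  rw [Complex.ofReal_sub, norm₂_sq, norm₂_sq, norm₂_sq, star_sub, sub_mul, mul_sub, mul_sub]
  simp only [map_sub]
  rw [← h1, ← h2]
  ring

theorem norm₂_condExp_le (hAM : A ≤ M) (x : Elem M) : τ.norm₂ (τ.condExp A x) ≤ τ.norm₂ x := by
  have h := τ.norm₂_sub_condExp_sq hAM x
  have := sq_nonneg (τ.norm₂ (x - τ.condExp A x))
  exact le_of_sq_le_sq (by linarith) (τ.norm₂_nonneg x)

theorem norm₂_sub_le (x y : Elem M) : τ.norm₂ (x - y) ≤ τ.norm₂ x + τ.norm₂ y := by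
  rw [← norm_toL2, ← norm_toL2, ← norm_toL2, map_sub]
  exact norm_sub_le _ _

/-! ### The mixing defect -/

/-- The failure `E_A(a x b) - E_A(a) x E_A(b)` of the conditional expectation to be multiplicative,
as a function of `x`. -/
def mixingDefect (hAM : A ≤ M) (a b : Elem M) : Elem M →ₗ[ℂ] Elem M where
  toFun x := τ.condExp A (a * x * b) - τ.condExp A a * x * τ.condExp A b
  map_add' x y := by
    rw [mul_add, add_mul, condExp_add τ hAM, mul_add, add_mul]
    abel
  map_smul' c x := by
    simp [condExp_smul τ hAM, smul_sub]

theorem mixingDefect_apply (hAM : A ≤ M) (a b x : Elem M) : τ.mixingDefect hAM a b x =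
    τ.condExp A (a * x * b) - τ.condExp A a * x * τ.condExp A b := rfl

theorem mixingDefect_add_left (hAM : A ≤ M) (a a' b x : Elem M) :
    τ.mixingDefect hAM (a + a') b x = τ.mixingDefect hAM a b x + τ.mixingDefect hAM a' b x := by
  simp only [mixingDefect_apply, condExp_add τ hAM, add_mul]
  abel

theorem mixingDefect_add_right (hAM : A ≤ M) (a b b' x : Elem M) :
    τ.mixingDefect hAM a (b + b') x = τ.mixingDefect hAM a b x + τ.mixingDefect hAM a b' x := by
  simp only [mixingDefect_apply, condExp_add τ hAM, mul_add]
  abel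

theorem mixingDefect_smul_left (hAM : A ≤ M) (c : ℂ) (a b x : Elem M) :
    τ.mixingDefect hAM (c • a) b x = c • τ.mixingDefect hAM a b x := by
  simp [mixingDefect_apply, condExp_smul τ hAM, smul_sub]

theorem mixingDefect_smul_right (hAM : A ≤ M) (c : ℂ) (a b x : Elem M) :
    τ.mixingDefect hAM a (c • b) x = c • τ.mixingDefect hAM a b x := by
  simp [mixingDefect_apply, condExp_smul τ hAM, smul_sub]

theorem norm₂_mixingDefect_le (hAM : A ≤ M) (a b x : Elem M) :
    τ.norm₂ (τ.mixingDefect hAM a b x) ≤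
      2 * ‖(a : H →L[ℂ] H)‖ * ‖(b : H →L[ℂ] H)‖ * τ.norm₂ x := by
  have key : ∀ c d : Elem M, ‖(c : H →L[ℂ] H)‖ ≤ ‖(a : H →L[ℂ] H)‖ →
      ‖(d : H →L[ℂ] H)‖ ≤ ‖(b : H →L[ℂ] H)‖ →
      τ.norm₂ (c * x * d) ≤ ‖(a : H →L[ℂ] H)‖ * τ.norm₂ x * ‖(b : H →L[ℂ] H)‖ := by
    intro c d hc hd
    have h0 := τ.norm₂_nonneg x
    refine (τ.norm₂_mul_le_right _ _).trans ?_
    gcongr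
    refine (τ.norm₂_mul_le_left _ _).trans ?_
    gcongr
  have h1 := (τ.norm₂_condExp_le hAM _).trans (key a b le_rfl le_rfl)
  have h2 := key _ _ (τ.condExp_spec hAM a).2.1 (τ.condExp_spec hAM b).2.1
  rw [mixingDefect_apply]
  refine (τ.norm₂_sub_le _ _).trans ?_
  linarith

theorem norm₂_mixingDefect_unitary_le_left (hAM : A ≤ M) (a b : Elem M) {w : Elem M}
    (hw : w ∈ unitary (Elem M)) :
    τ.norm₂ (τ.mixingDefect hAM a b w) ≤ 2 * ‖(b : H →L[ℂ] H)‖ * τ.norm₂ a := by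
  have h1 : τ.norm₂ (a * w * b) ≤ τ.norm₂ a * ‖(b : H →L[ℂ] H)‖ := by
    rw [← τ.norm₂_mul_unitary hw a]
    exact τ.norm₂_mul_le_right _ _
  have h2 : τ.norm₂ (τ.condExp A a * w * τ.condExp A b) ≤ τ.norm₂ a * ‖(b : H →L[ℂ] H)‖ := by
    refine (τ.norm₂_mul_le_right _ _).trans ?_
    rw [τ.norm₂_mul_unitary hw]
    exact mul_le_mul (τ.norm₂_condExp_le hAM a) (τ.condExp_spec hAM b).2.1 (norm_nonneg _)
      (τ.norm₂_nonneg _)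
  have h3 := (τ.norm₂_condExp_le hAM _).trans h1
  rw [mixingDefect_apply]
  refine (τ.norm₂_sub_le _ _).trans ?_
  linarith

theorem norm₂_mixingDefect_unitary_le_right (hAM : A ≤ M) (a b : Elem M) {w : Elem M}
    (hw : w ∈ unitary (Elem M)) :
    τ.norm₂ (τ.mixingDefect hAM a b w) ≤ 2 * ‖(a : H →L[ℂ] H)‖ * τ.norm₂ b := by
  have h1 : τ.norm₂ (a * w * b) ≤ ‖(a : H →L[ℂ] H)‖ * τ.norm₂ b := by
    rw [← τ.norm₂_unitary_mul hw b, mul_assoc]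
    exact τ.norm₂_mul_le_left _ _
  have h2 : τ.norm₂ (τ.condExp A a * w * τ.condExp A b) ≤ ‖(a : H →L[ℂ] H)‖ * τ.norm₂ b := by
    rw [mul_assoc]
    refine (τ.norm₂_mul_le_left _ _).trans ?_
    rw [τ.norm₂_unitary_mul hw]
    exact mul_le_mul (τ.condExp_spec hAM a).2.1 (τ.norm₂_condExp_le hAM b)
      (τ.norm₂_nonneg _) (norm_nonneg _)
  have h3 := (τ.norm₂_condExp_le hAM _).trans h1
  rw [mixingDefect_apply]
  refine (τ.norm₂_sub_le _ _).trans ?_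
  linarith

theorem tendsto_mixingDefect_of_summable (hAM : A ≤ M) {v : ℕ → Elem M}
    (hv : Orthonormal ℂ (fun n => τ.toL2 (v n)))
    (hvspan : (Submodule.span ℂ (Set.range fun n => τ.toL2 (v n))).topologicalClosure = τ.L2Sub A)
    {a b : Elem M} (hsum : Summable fun n => τ.norm₂ (τ.mixingDefect hAM a b (v n)) ^ 2)
    {w : ℕ → Elem M} (hw : ∀ n, w n ∈ unitary (Elem M)) (hwA : ∀ n, (w n : H →L[ℂ] H) ∈ A)
    (h0 : ∀ y : Elem M, Tendsto (fun n => τ (y * w n)) atTop (𝓝 0)) :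
    Tendsto (fun n => τ.norm₂ (τ.mixingDefect hAM a b (w n))) atTop (𝓝 0) := by
  have hb : ∃ C, ∀ x, ‖(τ.toL2 ∘ₗ τ.mixingDefect hAM a b) x‖ ≤ C * ‖τ.toL2 x‖ :=
    ⟨_, fun x => by
      simp only [LinearMap.comp_apply, norm_toL2]
      exact τ.norm₂_mixingDefect_le hAM a b x⟩
  -- The 2-norm bound extends the defect to L²(M), where the Hilbert–Schmidt argument applies.
  set T : τ.L2 →L[ℂ] τ.L2 := (τ.toL2 ∘ₗ τ.mixingDefect hAM a b).extendOfNorm τ.toL2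
  have hT : ∀ x, ‖T (τ.toL2 x)‖ = τ.norm₂ (τ.mixingDefect hAM a b x) := fun x => by
    simp only [T]
    rw [LinearMap.extendOfNorm_eq τ.denseRange_toL2 hb, LinearMap.comp_apply, norm_toL2]
  have h1 : ∀ k, ‖τ.toL2 (w k)‖ ≤ ‖τ.toL2 1‖ := fun k => by
    rw [norm_toL2, norm_toL2, ← mul_one (w k), τ.norm₂_unitary_mul (hw k)]
  have := tendsto_zero_of_summable_norm_sq hv T (by simpa only [hT] using hsum) h1
    (fun k => by rw [hvspan]; exact τ.toL2_mem_L2Sub (hwA k))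
    (fun n => by simpa only [inner_toL2] using h0 (star (v n)))
  simpa only [hT] using this

theorem exists_norm₂_sub_lt {Y : Set (Elem M)}
    (hY : (Submodule.span ℂ (τ.toL2 '' Y)).topologicalClosure = ⊤) (x : Elem M) {ε : ℝ}
    (hε : 0 < ε) : ∃ y ∈ Submodule.span ℂ Y, τ.norm₂ (x - y) < ε := by
  have hx : τ.toL2 x ∈ closure (Submodule.span ℂ (τ.toL2 '' Y) : Set τ.L2) := by
    rw [← Submodule.topologicalClosure_coe, hY]
    trivial
  obtain ⟨z, hz, hxz⟩ := Metric.mem_closure_iff.mp hx ε hε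
  rw [Submodule.span_image] at hz
  obtain ⟨y, hy, rfl⟩ := hz
  refine ⟨y, hy, ?_⟩
  rwa [← norm_toL2, map_sub, ← dist_eq_norm]

theorem norm₂_add_le (x y : Elem M) : τ.norm₂ (x + y) ≤ τ.norm₂ x + τ.norm₂ y := by
  rw [← norm_toL2, ← norm_toL2, ← norm_toL2, map_add]
  exact norm_add_le _ _

/-- Convergence to zero in the `2`-norm passes from a set to its linear span. -/
theorem tendsto_norm₂_of_mem_span {Y : Set (Elem M)} (F : ℕ → Elem M →ₗ[ℂ] Elem M)
    (hF : ∀ y ∈ Y, Tendsto (fun n => τ.norm₂ (F n y)) atTop (𝓝 0)) {x : Elem M}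
    (hx : x ∈ Submodule.span ℂ Y) : Tendsto (fun n => τ.norm₂ (F n x)) atTop (𝓝 0) := by
  simp only [← norm_toL2, ← tendsto_zero_iff_norm_tendsto_zero] at hF ⊢
  induction hx using Submodule.span_induction with
  | mem y hy => exact hF y hy
  | zero => simp
  | add x y _ _ hx hy => simpa using hx.add hy
  | smul c x _ hx => simpa using hx.const_smul c

/-- Extension of a limit from a set with dense span, for equicontinuous families. -/
theorem tendsto_norm₂_of_dense_span {Y : Set (Elem M)}
    (hY : (Submodule.span ℂ (τ.toL2 '' Y)).topologicalClosure = ⊤)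
    (F : ℕ → Elem M →ₗ[ℂ] Elem M) {C : ℝ} (hC : ∀ n x, τ.norm₂ (F n x) ≤ C * τ.norm₂ x)
    (hF : ∀ y ∈ Y, Tendsto (fun n => τ.norm₂ (F n y)) atTop (𝓝 0)) (x : Elem M) :
    Tendsto (fun n => τ.norm₂ (F n x)) atTop (𝓝 0) := by
  rw [Metric.tendsto_atTop]
  intro ε hε
  obtain ⟨y, hy, hxy⟩ := τ.exists_norm₂_sub_lt hY x (ε := ε / 2 / (|C| + 1)) (by positivity)
  obtain ⟨N, hN⟩ := Metric.tendsto_atTop.mp (τ.tendsto_norm₂_of_mem_span F hF hy) (ε / 2)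
    (by positivity)
  refine ⟨N, fun n hn => ?_⟩
  have h1 := hN n hn
  rw [dist_zero_right, Real.norm_of_nonneg (τ.norm₂_nonneg _)] at h1 ⊢
  have h2 : τ.norm₂ (F n (x - y)) ≤ ε / 2 := by
    refine (hC n _).trans ?_
    have h3 : (|C| + 1) * (ε / 2 / (|C| + 1)) = ε / 2 := by field_simp
    rw [← h3]
    have := le_abs_self C
    exact mul_le_mul (by linarith) hxy.le (τ.norm₂_nonneg _) (by positivity)
  have h4 := τ.norm₂_add_le (F n (x - y)) (F n y)
  rw [← map_add, sub_add_cancel] at h4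
  linarith

theorem isMixing_of_summable (hAM : A ≤ M) {Y : Set (Elem M)}
    (hY : (Submodule.span ℂ (τ.toL2 '' Y)).topologicalClosure = ⊤) {v : ℕ → Elem M}
    (hv : Orthonormal ℂ (fun n => τ.toL2 (v n)))
    (hvspan : (Submodule.span ℂ (Set.range fun n => τ.toL2 (v n))).topologicalClosure = τ.L2Sub A)
    (hsum : ∀ a ∈ Y, ∀ b ∈ Y, Summable fun n =>
      τ.norm₂ (τ.condExp A (a * v n * b) - τ.condExp A a * v n * τ.condExp A b) ^ 2) :
    τ.IsMixing A := by
  intro w hw hwA hw0 a b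
  have h0 : ∀ y : Elem M, Tendsto (fun n => τ (y * w n)) atTop (𝓝 0) := by
    intro y
    rw [ContinuousLinearMapWOT.tendsto_iff_forall_inner_apply_tendsto] at hw0
    have := τ.tendsto_mul_of_tendsto_inner (l := atTop) (f := w) (a := 0) (C := 1)
      (Eventually.of_forall fun n => ?_) (fun ξ η => hw0 ξ η) y
    · simpa using this
    · exact norm_le_one_of_star_mul_self_eq_one (congrArg Subtype.val (hw n).1)
  let L (b : Elem M) (n : ℕ) : Elem M →ₗ[ℂ] Elem M :=
    { toFun := fun a => τ.mixingDefect hAM a b (w n)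
      map_add' := fun a a' => τ.mixingDefect_add_left hAM a a' b (w n)
      map_smul' := fun c a => τ.mixingDefect_smul_left hAM c a b (w n) }
  let R (a : Elem M) (n : ℕ) : Elem M →ₗ[ℂ] Elem M :=
    { toFun := fun b => τ.mixingDefect hAM a b (w n)
      map_add' := fun b b' => τ.mixingDefect_add_right hAM a b b' (w n)
      map_smul' := fun c b => τ.mixingDefect_smul_right hAM c a b (w n) }
  -- Reduce `a` to Y with `b` arbitrary, then `b` to Y with `a` already in Y; each constant depends
  -- only on the variable held fixed.
  refine τ.tendsto_norm₂_of_dense_span hY (L b)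
    (fun n a => τ.norm₂_mixingDefect_unitary_le_left hAM a b (hw n)) (fun a ha => ?_) a
  refine τ.tendsto_norm₂_of_dense_span hY (R a)
    (fun n b => τ.norm₂_mixingDefect_unitary_le_right hAM a b (hw n)) (fun b hb => ?_) b
  exact τ.tendsto_mixingDefect_of_summable hAM hv hvspan (hsum a ha b hb) hw hwA h0

end FaithfulNormalTrace

/-! ### Corners of a diffuse von Neumann algebra -/

/-- The map `d ↦ c d c` on `A`. -/
def compress (A : VonNeumannAlgebra H) (c : H →L[ℂ] H) : Elem A →ₗ[ℂ] (H →L[ℂ] H) where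
  toFun d := c * d * c
  map_add' x y := by simp [mul_add, add_mul]
  map_smul' r x := by simp

theorem compress_apply (A : VonNeumannAlgebra H) (c : H →L[ℂ] H) (d : Elem A) :
    compress A c d = c * d * c := rfl

/-- Induction on dim pAp: a proper subprojection q has qAq strictly smaller, since p ∈ qAq would
give p = q. -/
theorem IsDiffuse.not_finite_range_compress_projection {A : VonNeumannAlgebra H}
    (hA : IsDiffuse A) {p : H →L[ℂ] H} (hpA : p ∈ A) (hp : IsStarProjection p) (hp0 : p ≠ 0) :
    ¬ FiniteDimensional ℂ (LinearMap.range (compress A p)) := by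
  intro hfin
  induction hn : Module.finrank ℂ (LinearMap.range (compress A p)) using Nat.strong_induction_on
    generalizing p with
  | _ n ih =>
    obtain ⟨q, hqA, hq, hpq, hq0, hqp⟩ := hA p hpA hp hp0
    have hqp' : q * p = q := by
      have := congrArg star hpq
      rwa [star_mul, hq.isSelfAdjoint.star_eq, hp.isSelfAdjoint.star_eq] at this
    have hlt : LinearMap.range (compress A q) < LinearMap.range (compress A p) := by
      refine lt_of_le_of_ne ?_ fun heq => ?_
      · rintro _ ⟨d, rfl⟩
        refine ⟨⟨q * d * q, mul_mem (mul_mem hqA d.2) hqA⟩, ?_⟩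
        simp only [compress_apply]
        rw [mul_assoc p, mul_assoc (q * d) q p, hqp', ← mul_assoc, ← mul_assoc, hpq]
      · have hmem : p ∈ LinearMap.range (compress A p) :=
          ⟨1, by simp [compress_apply, hp.isIdempotentElem.eq]⟩
        rw [← heq] at hmem
        obtain ⟨d, hd⟩ := hmem
        apply hqp
        rw [← hqp']
        nth_rewrite 2 [← hd]
        nth_rewrite 1 [← hd]
        simp only [compress_apply]
        rw [← mul_assoc, ← mul_assoc, hq.isIdempotentElem.eq]
    have hfin' := Submodule.finiteDimensional_of_le hlt.le
    exact ih _ (hn ▸ Submodule.finrank_lt_finrank_of_lt hlt) hqA hq hq0 hfin' rfl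

/-- P ↦ cP(c)c cannot be injective on polynomials, so a nonzero XPX annihilates c and its roots
contain the spectrum. -/
theorem finite_spectrum_of_finite_range_compress {A : VonNeumannAlgebra H} {c : H →L[ℂ] H}
    (hc : c ∈ A) (hfin : FiniteDimensional ℂ (LinearMap.range (compress A c))) :
    (spectrum ℝ c).Finite := by
  have hcoe : ∀ P : Polynomial ℂ,
      ((Polynomial.aeval (⟨c, hc⟩ : Elem A) P : Elem A) : H →L[ℂ] H) = Polynomial.aeval c P :=
    fun P => (Polynomial.aeval_algHom_apply A.toStarSubalgebra.subtype.toAlgHom _ P).symm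
  let f : Polynomial ℂ →ₗ[ℂ] LinearMap.range (compress A c) :=
    (compress A c).rangeRestrict ∘ₗ (Polynomial.aeval (⟨c, hc⟩ : Elem A)).toLinearMap
  have hninj : ¬ Function.Injective f := fun h =>
    Polynomial.not_finite (Module.Finite.of_injective f h)
  rw [← LinearMap.ker_eq_bot, Submodule.eq_bot_iff] at hninj
  push Not at hninj
  obtain ⟨P, hP, hP0⟩ := hninj
  have hQ : Polynomial.aeval c (Polynomial.X * P * Polynomial.X) = 0 := by
    have := congrArg Subtype.val (LinearMap.mem_ker.mp hP)
    simpa [f, compress_apply, hcoe] using this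
  have hQ0 : Polynomial.X * P * Polynomial.X ≠ 0 :=
    mul_ne_zero (mul_ne_zero Polynomial.X_ne_zero hP0) Polynomial.X_ne_zero
  have hC : (spectrum ℂ c).Finite := by
    refine (Polynomial.finite_setOfPred_isRoot hQ0).subset fun z hz => ?_
    have h1 := spectrum.subset_polynomial_aeval c (Polynomial.X * P * Polynomial.X)
      (Set.mem_image_of_mem _ hz)
    rw [hQ] at h1
    by_contra hne
    have h2 : spectrum ℂ (0 : H →L[ℂ] H) ⊆ {0} := by
      intro w hw
      by_contra hw0
      rw [spectrum.mem_iff, sub_zero] at hw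
      exact hw <| (IsUnit.mk0 w hw0).map (algebraMap ℂ (H →L[ℂ] H))
    exact hne (h2 h1)
  rw [← spectrum.preimage_algebraMap ℂ]
  exact hC.preimage (algebraMap ℝ ℂ).injective.injOn

theorem IsDiffuse.not_finite_range_compress {A : VonNeumannAlgebra H}
    (hA : IsDiffuse A) {c : H →L[ℂ] H} (hcA : c ∈ A) (hc : IsSelfAdjoint c) (hc0 : c ≠ 0) :
    ¬ FiniteDimensional ℂ (LinearMap.range (compress A c)) := by
  intro hfin
  have hspec := finite_spectrum_of_finite_range_compress hcA hfin
  have hcont : ∀ f : ℝ → ℝ, ContinuousOn f (spectrum ℝ c) := fun f => hspec.continuousOn f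
  have hid : cfc (fun t : ℝ => t) c = c := cfc_id' ℝ c
  let g := cfc (fun t : ℝ => t⁻¹ * t⁻¹) c
  have hgA : g ∈ A := cfc_mem A hcA _
  -- The support projection of c, as 0⁻¹ = 0. On a finite spectrum every function is continuous, and
  -- p = cgc gives pAp ⊆ cAc.
  let p := cfc (fun t : ℝ => t * (t⁻¹ * t⁻¹) * t) c
  have hp : p = c * g * c := by
    simp only [p, g]
    rw [cfc_mul (fun t : ℝ => t * (t⁻¹ * t⁻¹)) (fun t => t) c (hcont _) (hcont _),
      cfc_mul (fun t : ℝ => t) (fun t => t⁻¹ * t⁻¹) c (hcont _) (hcont _), hid]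
  have hpp : p * p = p := by
    simp only [p]
    rw [← cfc_mul _ _ c (hcont _) (hcont _)]
    refine cfc_congr fun t _ => ?_
    rcases eq_or_ne t 0 with rfl | ht
    · simp
    · field_simp
  have hcp : c * p = c := by
    conv_lhs => rw [← hid]
    simp only [p]
    rw [← cfc_mul _ _ c (hcont _) (hcont _)]
    conv_rhs => rw [← hid]
    refine cfc_congr fun t _ => ?_
    rcases eq_or_ne t 0 with rfl | ht
    · simp
    · field_simp
  have hp0 : p ≠ 0 := fun h => hc0 (by rw [← hcp, h, mul_zero])
  have hps : IsStarProjection p := ⟨hpp, cfc_predicate _ _⟩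
  refine hA.not_finite_range_compress_projection (cfc_mem A hcA _) hps hp0 ?_
  refine Submodule.finiteDimensional_of_le (S₂ := LinearMap.range (compress A c)) ?_
  rintro _ ⟨d, rfl⟩
  refine ⟨⟨g * c * d * (c * g), mul_mem (mul_mem (mul_mem hgA hcA) d.2) (mul_mem hcA hgA)⟩, ?_⟩
  change c * (g * c * d * (c * g)) * c = p * d * p
  rw [hp]
  simp only [mul_assoc]

/-- Otherwise d ↦ cdc would factor through A/ker φ, and its range would be finite-dimensional. -/
theorem IsDiffuse.exists_compress_ne_zero {A : VonNeumannAlgebra H}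
    (hA : IsDiffuse A) {c : H →L[ℂ] H} (hcA : c ∈ A) (hc : IsSelfAdjoint c) (hc0 : c ≠ 0)
    {V : Type*} [AddCommGroup V] [Module ℂ V] [FiniteDimensional ℂ V] (φ : Elem A →ₗ[ℂ] V) :
    ∃ d : Elem A, φ d = 0 ∧ compress A c d ≠ 0 := by
  by_contra! hcon
  refine hA.not_finite_range_compress hcA hc hc0 ?_
  have hle : LinearMap.ker φ ≤ LinearMap.ker (compress A c) := fun d hd => hcon d hd
  have h1 : FiniteDimensional ℂ (Elem A ⧸ LinearMap.ker φ) :=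
    (LinearMap.quotKerEquivRange φ).symm.finiteDimensional
  rw [← Submodule.range_liftQ (LinearMap.ker φ) (compress A c) hle]
  infer_instance

/-! ### Perturbing self-adjoint contractions -/

theorem norm_le_one_of_neg_one_le {x : H →L[ℂ] H} (hx : IsSelfAdjoint x) (h1 : -1 ≤ x)
    (h2 : x ≤ 1) : ‖x‖ ≤ 1 := by
  have h1' : algebraMap ℝ (H →L[ℂ] H) (-1) ≤ x := by simpa using h1
  have h2' : x ≤ algebraMap ℝ (H →L[ℂ] H) 1 := by simpa using h2
  rw [algebraMap_le_iff_le_spectrum] at h1'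
  rw [le_algebraMap_iff_spectrum_le] at h2'
  rw [← cfc_id ℝ x]
  exact norm_cfc_le zero_le_one fun t ht => abs_le.mpr ⟨h1' t ht, h2' t ht⟩

theorem norm_add_conjugate_le_one {a d c : H →L[ℂ] H} (ha : IsSelfAdjoint a) (ha1 : ‖a‖ ≤ 1)
    (hc : c = (1 / 2 : ℝ) • (1 - a * a)) (hd : IsSelfAdjoint d) (hd1 : ‖d‖ ≤ 1) :
    ‖a + c * d * c‖ ≤ 1 := by
  have hcs : star c = c := by
    rw [hc]
    simp [ha.star_eq]
  have key : ∀ a d : H →L[ℂ] H, IsSelfAdjoint a → ‖a‖ ≤ 1 → c = (1 / 2 : ℝ) • (1 - a * a) →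
      IsSelfAdjoint d → ‖d‖ ≤ 1 → a + c * d * c ≤ 1 := by
    intro a d ha ha1 hc hd hd1
    have h1 : 0 ≤ (1 - a) * (1 - a) := by
      have := star_mul_self_nonneg (1 - a)
      rwa [star_sub, star_one, ha.star_eq] at this
    have h2 : 0 ≤ 1 - a * a * (a * a) := by
      have := CStarAlgebra.star_mul_le_algebraMap_norm_sq (a := a * a)
      rw [star_mul, ha.star_eq] at this
      refine sub_nonneg.mpr (this.trans ?_)
      have hn : ‖a * a‖ ^ 2 ≤ 1 := by
        exact pow_le_one₀ (norm_nonneg _)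
          ((norm_mul_le a a).trans (mul_le_one₀ ha1 (norm_nonneg _) ha1))
      rw [← map_one (algebraMap ℝ (H →L[ℂ] H))]
      exact algebraMap_mono _ hn
    have h3 : c * d * c ≤ c * c := by
      have := CStarAlgebra.star_left_conjugate_le_norm_smul (a := c) (b := d) hd
      rw [hcs] at this
      refine this.trans ?_
      have h0 : 0 ≤ c * c := by
        have := star_mul_self_nonneg c
        rwa [hcs] at this
      simpa using smul_le_smul_of_nonneg_right hd1 h0
    -- A sum of three positive terms; the lower bound follows from (a, d) ↦ (−a, −d), which leaves c
    -- unchanged.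
    have e : 1 - (a + c * d * c) = (1 / 2 : ℝ) • ((1 - a) * (1 - a))
        + (1 / 4 : ℝ) • (1 - a * a * (a * a)) + (c * c - c * d * c) := by
      have hcc : c * c = (1 / 4 : ℝ) • (1 - a * a - a * a + a * a * (a * a)) := by
        have h22 : (1 - a * a) * (1 - a * a) = 1 - a * a - a * a + a * a * (a * a) := by
          noncomm_ring
        rw [hc, smul_mul_smul_comm, h22]
        norm_num
      have h11 : (1 - a) * (1 - a) = 1 - a - a + a * a := by noncomm_ring
      rw [hcc, h11]
      module
    rw [← sub_nonneg, e]
    exact add_nonneg (add_nonneg (smul_nonneg (by norm_num) h1) (smul_nonneg (by norm_num) h2))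
      (sub_nonneg.mpr h3)
  have hs : IsSelfAdjoint (a + c * d * c) := by
    have := hd.conjugate c
    rw [hcs] at this
    exact ha.add this
  refine norm_le_one_of_neg_one_le hs ?_ (key a d ha ha1 hc hd hd1)
  have := key (-a) (-d) ha.neg (by rwa [norm_neg]) (by rwa [neg_mul_neg]) hd.neg
    (by rwa [norm_neg])
  rw [neg_le]
  refine le_trans (le_of_eq ?_) this
  noncomm_ring

/-! ### A weakly null sequence of unitaries -/

namespace FaithfulNormalTrace

variable {M : VonNeumannAlgebra H} (τ : FaithfulNormalTrace M) {A : VonNeumannAlgebra H}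

/-- The self-adjoint contractions of `A` that are orthogonal to `s`. -/
def contractionsPerp (A : VonNeumannAlgebra H) (s : Finset (Elem M)) : Set (Elem M) :=
  {a | (a : H →L[ℂ] H) ∈ A ∧ star a = a ∧ ‖(a : H →L[ℂ] H)‖ ≤ 1 ∧ ∀ y ∈ s, τ (y * a) = 0}

/-- An element of `M` as the function `y ↦ τ(y x)`. -/
def pairing : Elem M →ₗ[ℂ] Elem M → ℂ where
  toFun x y := τ (y * x)
  map_add' x x' := by ext; simp [mul_add]
  map_smul' c x := by ext; simp

theorem pairing_injective : Function.Injective τ.pairing := by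
  rw [← LinearMap.ker_eq_bot, LinearMap.ker_eq_bot']
  intro x hx
  exact τ.faithful x (congrFun hx (star x))

/-- Transport to the product space `Elem M → ℂ` makes the weak topology concrete and Krein–Milman
available. -/
theorem isCompact_pairing_image_contractionsPerp (hAM : A ≤ M) (s : Finset (Elem M)) :
    IsCompact (τ.pairing '' τ.contractionsPerp A s) := by
  rw [isCompact_iff_ultrafilter_le_nhds']
  intro U hmem
  have hVU := Ultrafilter.ofComapInfPrincipal_eq_of_map hmem
  have hV := Ultrafilter.ofComapInfPrincipal_mem hmem
  set V := Ultrafilter.ofComapInfPrincipal hmem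
  obtain ⟨a, haA, haC, -, hat⟩ := τ.exists_ultrafilter_limit hAM V id 1
    (Filter.mem_of_superset hV fun a ha => ha.1) (Filter.mem_of_superset hV fun a ha => ha.2.2.1)
  refine ⟨τ.pairing a, ⟨a, ⟨haA, ?_, haC, fun y hy => ?_⟩, rfl⟩, ?_⟩
  · refine τ.pairing_injective (funext fun y => ?_)
    have h1 := (Complex.continuous_conj.tendsto _).comp (hat (star y))
    rw [← τ.map_star, star_mul, star_star, τ.tracial] at h1
    refine tendsto_nhds_unique_of_eventuallyEq h1 (hat y) (Filter.mem_of_superset hV fun x hx => ?_)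
    change (starRingEnd ℂ) (τ (star y * x)) = τ (y * x)
    rw [← τ.map_star, star_mul, star_star, τ.tracial, hx.2.1]
  · refine tendsto_nhds_unique_of_eventuallyEq (hat y) tendsto_const_nhds
      (Filter.mem_of_superset hV fun x hx => hx.2.2.2 y hy)
  · have : Tendsto τ.pairing V (𝓝 (τ.pairing a)) := tendsto_pi_nhds.mpr hat
    rw [← hVU]
    exact this

/-- The set of self-adjoint contractions of `A` orthogonal to `s` has an extreme point. -/
theorem exists_extreme_contractionsPerp (hAM : A ≤ M) (s : Finset (Elem M)) :
    ∃ a ∈ τ.contractionsPerp A s, ∀ b : Elem M,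
      a + b ∈ τ.contractionsPerp A s → a - b ∈ τ.contractionsPerp A s → b = 0 := by
  obtain ⟨z, hz⟩ := (τ.isCompact_pairing_image_contractionsPerp hAM s).extremePoints_nonempty
    ⟨_, 0, ⟨A.toStarSubalgebra.zero_mem, star_zero _, by simp, by simp⟩, rfl⟩
  rw [mem_extremePoints] at hz
  obtain ⟨⟨a, ha, rfl⟩, hext⟩ := hz
  refine ⟨a, ha, fun b h1 h2 => ?_⟩
  have h3 := (hext _ ⟨_, h1, rfl⟩ _ ⟨_, h2, rfl⟩
    ⟨1 / 2, 1 / 2, by norm_num, by norm_num, by norm_num, ?_⟩).1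
  · simpa using τ.pairing_injective h3
  · rw [map_add, map_sub]
    module

theorem exists_selfAdjoint_compress_ne_zero (hAM : A ≤ M) (hA : IsDiffuse A) {s : Finset (Elem M)}
    (hs : ∀ y ∈ s, star y = y) {c : Elem M} (hcA : (c : H →L[ℂ] H) ∈ A) (hc : star c = c)
    (hc0 : c ≠ 0) : ∃ d : Elem M, (d : H →L[ℂ] H) ∈ A ∧ star d = d ∧ c * d * c ≠ 0 ∧
      ∀ y ∈ s, τ (y * (c * d * c)) = 0 := by
  let incl : Elem A →ₗ[ℂ] Elem M :=
    { toFun := fun x => ⟨x, hAM x.2⟩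
      map_add' := fun _ _ => rfl
      map_smul' := fun _ _ => rfl }
  let φ : Elem A →ₗ[ℂ] (s → ℂ) := LinearMap.pi fun y =>
    τ.toLinearMap ∘ₗ LinearMap.mulLeft ℂ (y : Elem M) ∘ₗ LinearMap.mulRight ℂ c ∘ₗ
      LinearMap.mulLeft ℂ c ∘ₗ incl
  obtain ⟨d₀, hφ, hne⟩ := hA.exists_compress_ne_zero hcA (congrArg Subtype.val hc)
    (fun h => hc0 (Subtype.ext h)) φ
  set d := incl d₀
  have hdA : (d : H →L[ℂ] H) ∈ A := d₀.2
  have hd0 : c * d * c ≠ 0 := fun h => hne (congrArg Subtype.val h)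
  have hd : ∀ y ∈ s, τ (y * (c * d * c)) = 0 := fun y hy => congrFun hφ ⟨y, hy⟩
  have hdstar : ∀ y ∈ s, τ (y * (c * star d * c)) = 0 := fun y hy => by
    have h := congrArg (starRingEnd ℂ) (hd y hy)
    rw [map_zero, ← τ.map_star] at h
    simp only [star_mul, hc, hs y hy] at h
    rw [τ.tracial, ← mul_assoc] at h
    exact h
  -- The real or the imaginary part of d has nonzero compression; both stay orthogonal to `s`
  -- because its elements are self-adjoint.
  by_cases h1 : c * (d + star d) * c = 0
  · refine ⟨Complex.I • (d - star d), ?_, ?_, fun h2 => hd0 ?_, fun y hy => ?_⟩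
    · exact A.toStarSubalgebra.smul_mem (sub_mem hdA (star_mem (s := A) hdA)) _
    · rw [star_smul, star_sub, star_star, Complex.star_def, Complex.conj_I, neg_smul, ← smul_neg,
        neg_sub]
    · rw [mul_smul_comm, smul_mul_assoc, smul_eq_zero_iff_right Complex.I_ne_zero, mul_sub,
        sub_mul, sub_eq_zero] at h2
      rw [mul_add, add_mul, ← h2, ← two_smul ℂ] at h1
      exact (smul_eq_zero_iff_right two_ne_zero).mp h1
    · rw [mul_smul_comm, smul_mul_assoc, mul_smul_comm, map_smul, mul_sub, sub_mul, mul_sub,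
        map_sub, hd y hy, hdstar y hy, sub_zero, smul_zero]
  · refine ⟨d + star d, add_mem hdA (star_mem (s := A) hdA), ?_, h1, fun y hy => ?_⟩
    · rw [star_add, star_star, add_comm]
    · rw [mul_add, add_mul, mul_add, map_add, hd y hy, hdstar y hy, add_zero]

/-- At an extreme point a with a² ≠ 1, put c = (1 − a²)/2. Diffuseness yields a contraction e with
cec ≠ 0 orthogonal to `s`, and both a ± cec remain in the set, a contradiction. -/
theorem exists_symmetry_perp (hAM : A ≤ M) (hA : IsDiffuse A) {s : Finset (Elem M)}
    (hs : ∀ y ∈ s, star y = y) : ∃ a : Elem M, (a : H →L[ℂ] H) ∈ A ∧ star a = a ∧ a * a = 1 ∧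
      ∀ y ∈ s, τ (y * a) = 0 := by
  obtain ⟨a, ⟨haA, has, ha1, hay⟩, hext⟩ := τ.exists_extreme_contractionsPerp hAM s
  refine ⟨a, haA, has, ?_, hay⟩
  by_contra hne
  obtain ⟨c, hcdef⟩ : ∃ c : Elem M, c = (1 / 2 : ℝ) • (1 - a * a) := ⟨_, rfl⟩
  have hcA : (c : H →L[ℂ] H) ∈ A := by
    have h1 : ((1 - a * a : Elem M) : H →L[ℂ] H) ∈ A :=
      sub_mem (one_mem A.toStarSubalgebra) (mul_mem haA haA)
    rw [hcdef]
    exact A.toStarSubalgebra.smul_mem h1 ((1 / 2 : ℝ) : ℂ)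
  have hc : star c = c := by simp [hcdef, has]
  have hc0 : c ≠ 0 := fun h => hne <| by
    have h2 : (2 : ℝ) • c = 1 - a * a := by rw [hcdef, smul_smul]; norm_num
    rw [h, smul_zero] at h2
    exact (sub_eq_zero.mp h2.symm).symm
  obtain ⟨d, hdA, hds, hd0, hdy⟩ := τ.exists_selfAdjoint_compress_ne_zero hAM hA hs hcA hc hc0
  have hdn : 0 < ‖(d : H →L[ℂ] H)‖ := by
    rw [norm_pos_iff]
    intro h
    have : d = 0 := Subtype.ext h
    exact hd0 (by rw [this, mul_zero, zero_mul])
  set r : ℝ := ‖(d : H →L[ℂ] H)‖⁻¹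
  have hr : r ≠ 0 := (inv_pos.mpr hdn).ne'
  set e : Elem M := r • d
  have heA : (e : H →L[ℂ] H) ∈ A := A.toStarSubalgebra.smul_mem hdA (r : ℂ)
  have hes : star e = e := by simp [e, hds]
  have he1 : ‖(e : H →L[ℂ] H)‖ ≤ 1 := by
    have : ‖(r • (d : H →L[ℂ] H))‖ = 1 := by
      rw [norm_smul, Real.norm_of_nonneg (inv_nonneg.mpr hdn.le), inv_mul_cancel₀ hdn.ne']
    exact this.le
  have hece : c * e * c = (r : ℂ) • (c * d * c) := by
    have : e = (r : ℂ) • d := rfl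
    rw [this, mul_smul_comm, smul_mul_assoc]
  have key : ∀ e : Elem M, (e : H →L[ℂ] H) ∈ A → star e = e → ‖(e : H →L[ℂ] H)‖ ≤ 1 →
      (∀ y ∈ s, τ (y * (c * e * c)) = 0) → a + c * e * c ∈ τ.contractionsPerp A s := by
    intro e heA hes he1 hey
    refine ⟨add_mem haA (mul_mem (mul_mem hcA heA) hcA), ?_, ?_, fun y hy => ?_⟩
    · simp only [star_add, star_mul, has, hc, hes, mul_assoc]
    · exact norm_add_conjugate_le_one (congrArg Subtype.val has) ha1
        (congrArg Subtype.val hcdef) (congrArg Subtype.val hes) he1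
    · rw [mul_add, map_add, hay y hy, hey y hy, add_zero]
  have hey : ∀ y ∈ s, τ (y * (c * e * c)) = 0 := fun y hy => by
    rw [hece, mul_smul_comm, map_smul, hdy y hy, smul_zero]
  have h1 := key e heA hes he1 hey
  have h2 := key (-e) (neg_mem heA) (by rw [star_neg, hes]) ((norm_neg (e : H →L[ℂ] H)).trans_le he1)
    (fun y hy => by rw [mul_neg, neg_mul, mul_neg, map_neg, hey y hy, neg_zero])
  rw [mul_neg, neg_mul, ← sub_eq_add_neg] at h2
  have h3 := hext _ h1 h2
  rw [hece, smul_eq_zero_iff_right (Complex.ofReal_ne_zero.mpr hr)] at h3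
  exact hd0 h3

/-- A diffuse von Neumann subalgebra has a sequence of unitaries which is weakly null. -/
theorem exists_unitary_tendsto_zero (τ : FaithfulNormalTrace M) (hAM : A ≤ M) (hA : IsDiffuse A) :
    ∃ w : ℕ → Elem M, (∀ n, w n ∈ unitary (Elem M)) ∧ (∀ n, (w n : H →L[ℂ] H) ∈ A) ∧
      Tendsto (fun n => (ContinuousLinearMapWOT.ofCLM (w n : H →L[ℂ] H) : H →WOT[ℂ] H))
        atTop (𝓝 0) := by
  obtain ⟨w, hw, hperp⟩ := exists_seq_of_forall_finset_exists
    (fun a : Elem M => (a : H →L[ℂ] H) ∈ A ∧ star a = a ∧ a * a = 1) (fun y a => τ (y * a) = 0)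
    (fun s hs => by
      obtain ⟨a, h1, h2, h3, h4⟩ := τ.exists_symmetry_perp hAM hA fun y hy => (hs y hy).2.1
      exact ⟨a, ⟨h1, h2, h3⟩, h4⟩)
  have hsq : ∀ n, star (w n) * w n = 1 := fun n => by rw [(hw n).2.1, (hw n).2.2]
  have horth : Orthonormal ℂ fun n => τ.toL2 (w n) := by
    refine ⟨fun n => ?_, fun m n hmn => ?_⟩
    · rw [norm_toL2, norm₂, hsq, τ.map_one, Complex.one_re, Real.sqrt_one]
    · change ⟪τ.toL2 (w m), τ.toL2 (w n)⟫_ℂ = 0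
      rw [inner_toL2, (hw m).2.1]
      rcases lt_or_gt_of_ne hmn with h | h
      · exact hperp m n h
      · rw [τ.tracial]
        exact hperp n m h
  -- The symmetries are orthonormal in L²(M), so Bessel's inequality applies.
  have hnull : ∀ y : Elem M, Tendsto (fun n => τ (y * w n)) atTop (𝓝 0) := by
    intro y
    have h1 := (horth.inner_products_summable (τ.toL2 (star y))).tendsto_atTop_zero
    have h2 : Tendsto (fun n => ‖τ (y * w n)‖ ^ 2) atTop (𝓝 0) := by
      refine h1.congr fun n => ?_
      rw [← norm_inner_symm, inner_toL2, star_star]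
    have h3 := h2.sqrt
    simp only [Real.sqrt_sq (norm_nonneg _), Real.sqrt_zero] at h3
    exact tendsto_zero_iff_norm_tendsto_zero.mpr h3
  refine ⟨w, fun n => ⟨hsq n, by rw [(hw n).2.1, (hw n).2.2]⟩, fun n => (hw n).1, ?_⟩
  -- Passage from τ to the weak operator topology: every ultrafilter limit a has τ(a*a) = 0, hence
  -- vanishes.
  rw [tendsto_iff_ultrafilter]
  intro U hU
  obtain ⟨a, -, -, hat, haτ⟩ := τ.exists_ultrafilter_limit hAM U w 1
    (Eventually.of_forall fun n => (hw n).1)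
    (Eventually.of_forall fun n =>
      norm_le_one_of_star_mul_self_eq_one (congrArg Subtype.val (hsq n)))
  have ha0 : a = 0 := τ.faithful a
    (tendsto_nhds_unique (haτ (star a)) ((hnull (star a)).mono_left hU))
  rw [ContinuousLinearMapWOT.tendsto_iff_forall_inner_apply_tendsto]
  intro ξ η
  have := hat ξ η
  rw [ha0] at this
  exact this

/-! ### Mixing subalgebras are singular -/

theorem IsMixing.isSingular (hAM : A ≤ M) (hA : IsDiffuse A) (h : τ.IsMixing A) :
    IsSingular M A := by
  rintro u ⟨huM, hu, himg⟩
  obtain ⟨w, hw, hwA, hw0⟩ := τ.exists_unitary_tendsto_zero hAM hA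
  set a : Elem M := ⟨u, huM⟩
  have ha : a ∈ unitary (Elem M) := ⟨Subtype.ext hu.1, Subtype.ext hu.2⟩
  have h1 : τ.norm₂ 1 = 1 := by simp [norm₂, τ.map_one]
  have ha1 : τ.norm₂ a = 1 := by rw [← mul_one a, τ.norm₂_unitary_mul ha, h1]
  have hsa : ‖((star a : Elem M) : H →L[ℂ] H)‖ ≤ 1 :=
    norm_le_one_of_star_mul_self_eq_one (congrArg Subtype.val (Unitary.star_mem ha).1)
  -- The first term lies in A and has 2-norm 1; the second has 2-norm at most ‖E_A(u)‖₂.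
  have hbound : ∀ n, 1 - τ.norm₂ (τ.condExp A a) ≤ τ.norm₂
      (τ.condExp A (a * w n * star a) - τ.condExp A a * w n * τ.condExp A (star a)) := by
    intro n
    have hmem : ((a * w n * star a : Elem M) : H →L[ℂ] H) ∈ A := by
      have : u * (w n : H →L[ℂ] H) * star u ∈ (A : Set (H →L[ℂ] H)) := by
        rw [← himg]
        exact Set.mem_image_of_mem _ (hwA n)
      exact this
    have h2 : τ.norm₂ (a * w n * star a) = 1 := by
      rw [τ.norm₂_mul_unitary (Unitary.star_mem ha), τ.norm₂_mul_unitary (hw n), ha1]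
    have h3 : τ.norm₂ (τ.condExp A a * w n * τ.condExp A (star a)) ≤ τ.norm₂ (τ.condExp A a) := by
      refine (τ.norm₂_mul_le_right _ _).trans ?_
      rw [τ.norm₂_mul_unitary (hw n)]
      exact mul_le_of_le_one_right (τ.norm₂_nonneg _)
        ((τ.condExp_spec hAM (star a)).2.1.trans hsa)
    rw [τ.condExp_of_mem hmem]
    have h4 := τ.norm₂_add_le
      (a * w n * star a - τ.condExp A a * w n * τ.condExp A (star a))
      (τ.condExp A a * w n * τ.condExp A (star a))
    rw [sub_add_cancel, h2] at h4
    linarith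
  have hge : 1 ≤ τ.norm₂ (τ.condExp A a) := by
    have := ge_of_tendsto' (h w hw hwA hw0 a (star a)) hbound
    linarith
  have hz := τ.norm₂_sub_condExp_sq hAM a
  rw [ha1] at hz
  have hz0 : τ.norm₂ (a - τ.condExp A a) = 0 := by
    have := sq_nonneg (τ.norm₂ (a - τ.condExp A a))
    exact pow_eq_zero_iff two_ne_zero |>.mp (by nlinarith)
  rw [← norm_toL2, norm_eq_zero, map_eq_zero_iff _ τ.toL2_injective, sub_eq_zero] at hz0
  have := (τ.condExp_spec hAM a).1
  rw [← hz0] at this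
  exact this

end FaithfulNormalTrace

end FiniteVN

end

theorem mainTheorem2 {H : Type*} [NormedAddCommGroup H] [InnerProductSpace ℂ H] [CompleteSpace H]
    (M : VonNeumannAlgebra H) (τ : FiniteVN.FaithfulNormalTrace M)
    (hsep : TopologicalSpace.SeparableSpace τ.L2)
    (A : VonNeumannAlgebra H) (hAM : A ≤ M) (hA : FiniteVN.IsDiffuse A)
    (Y : Set (FiniteVN.Elem M))
    (hY : (Submodule.span ℂ (τ.toL2 '' Y)).topologicalClosure = ⊤)
    (v : ℕ → FiniteVN.Elem M) (hvA : ∀ n, (v n : H →L[ℂ] H) ∈ A)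
    (hv : Orthonormal ℂ (fun n => τ.toL2 (v n)))
    (hvspan : (Submodule.span ℂ (Set.range fun n => τ.toL2 (v n))).topologicalClosure = τ.L2Sub A)
    (hsum : ∀ a ∈ Y, ∀ b ∈ Y, Summable fun n =>
      τ.norm₂ (τ.condExp A (a * v n * b) - τ.condExp A a * v n * τ.condExp A b) ^ 2) :
    τ.IsMixing A ∧ FiniteVN.IsSingular M A := by
  have h := τ.isMixing_of_summable hAM hY hv hvspan hsum
  exact ⟨h, h.isSingular τ hAM hA⟩
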